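/- Let $x:[0,1]\to[0,1]$ be the horizontal component of the Peano curve: if $t=\sum_{j\ge1}t_j3^{-j}$ with $t_j\in\{0,1,2\}$ and $k(n)=2-n$, then the ternary digits of $x(t)$ are, in order, $k^{0}(t_1),\,k^{t_2}(t_3),\,k^{t_2+t_4}(t_5),\,k^{t_2+t_4+t_6}(t_7),\dots$, where $k^v$ is the $v$-th iterate of $k$ (the value does not depend on the expansion of $t$ chosen). For $p>0$ put $$C_p=3^{\lfloor-\log_3p\rfloor}p\Bigl(1-\tfrac34\,3^{\lfloor-\log_3p\rfloor}p\Bigr),\qquad \varphi(c)=\frac{c}{C_c}\quad(c>0).$$ For $0\le t\le1$ and $c>0$ let $TV(x,[0,t],c)$ be the supremum of $\sum_i\max(|x(u_{i+1})-x(u_i)|-c,0)$ over finite partitions $0=u_0\le u_1\le\dots\le u_n=t$ (truncated variation). For $z\in\mathbb R$, $c>0$ let $\sigma_0=0$, $\tau_n=\inf\{u\in[\sigma_n,t]:x(u)\ge z+c/2\}$, $\sigma_{n+1}=\inf\{u\in[\tau_n,t]:x(u)<z-c/2\}$ (with $\inf\emptyset=+\infty$, $[+\infty,t]=\emptyset$),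 let $d^{z,c}(x,[0,t])=\max\{n:\sigma_n\le t\}$ be the number of downcrossings, and let $n^{z,c}(x,[0,t])=d^{z,c}(x,[0,t])+d^{-z,c}(-x,[0,t])$ be the number of crossings of $[z-c/2,z+c/2]$ by $x$ on $[0,t]$. A local time of $x$ is a function $L:[0,1]\times\mathbb R\to[0,\infty)$, $(t,z)\mapsto L_t^z$, such that for every $t\in[0,1]$ the function $z\mapsto L_t^z$ is Borel measurable and integrable and $\int_0^tg(x(s))\,ds=\int_{\mathbb R}g(z)L_t^z\,dz$ for all bounded Borel $g:\mathbb R\to\mathbb R$. Then: 1. For $c\in(0,1)$, $\varphi(c)=\bigl(3^{\lfloor-\log_3c\rfloor}(1-\tfrac34\,3^{\lfloor-\log_3c\rfloor}c)\bigr)^{-1}\ge0$; $\lim_{c\to0+}\varphi(c)=0$; $C_{3^kp}=C_p$ for all $p>0$, $k\in\mathbb Z$; and $\varphi$ is not differentiable at $3^{-n}$, $n=1,2,\dots$. 2. For every $p>0$ and $t\in[0,1]$, $\displaystyle\lim_{n\to\infty}3^{-n}p\;TV(x,[0,t],3^{-n}p)=C_p\,t$. 3. For every continuous $g:\mathbb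 R\to\mathbb R$, $t\in[0,1]$ and $c>0$ the function $z\mapsto n^{z,c}(x,[0,t])g(z)$ is integrable, and for every $p>0$, uniformly in $t\in[0,1]$, $$\lim_{n\to\infty}3^{-n}p\int_{\mathbb R}n^{z,3^{-n}p}(x,[0,t])\,g(z)\,dz=C_p\int_0^tg(x(s))\,ds.$$ 4. A local time of $x$ exists, and for every local time $L$ of $x$, every continuous $g:\mathbb R\to\mathbb R$ and every $t\in[0,1]$, $z\mapsto L_t^zg(z)$ is integrable and $$\lim_{c\to0+}\int_{\mathbb R}\varphi(c)\,n^{z,c}(x,[0,t])\,g(z)\,dz=\int_{\mathbb R}L_t^z\,g(z)\,dz.$$ -/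

import Mathlib

open MeasureTheory Filter Topology Set
open scoped ENNReal

noncomputable section

/-- Ternary digits of `t ∈ [0,1]`; the `j`-th entry (counted from `0`) is the digit
`t_{j+1}`, so that `t = ∑ j, peanoDigit t j * 3 ^ (-(j+1))`. The number `1` is `0.222…`. -/
def peanoDigit (t : ℝ) (j : ℕ) : Fin 3 :=
  if t = 1 then 2 else Real.digits t 3 j

/-- The horizontal component of the Peano curve,
`x(t) = 0.₃ k⁰(t₁) k^{t₂}(t₃) k^{t₂+t₄}(t₅) …` with `k(n) = 2 - n` on `{0,1,2}`
(`Fin.rev` on `Fin 3`). -/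
def peanoX (t : ℝ) : ℝ :=
  Real.ofDigits (b := 3) fun n =>
    (Fin.rev^[∑ i ∈ Finset.range n, (peanoDigit t (2 * i + 1) : ℕ)]) (peanoDigit t (2 * n))

/-- Truncated variation of `f` on `[s,t]` with truncation parameter `c`: the supremum over all
finite partitions `s = u 0 ≤ u 1 ≤ … ≤ u n = t` of `∑ max (|f (u (i+1)) - f (u i)| - c) 0`. -/
def truncatedVariation (f : ℝ → ℝ) (s t c : ℝ) : ℝ≥0∞ :=
  ⨆ (n : ℕ) (u : ℕ → ℝ) (_ : Monotone u ∧ u 0 = s ∧ u n = t),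
    ∑ i ∈ Finset.range n, ENNReal.ofReal (max (|f (u (i + 1)) - f (u i)| - c) 0)

/-- First time `u ∈ [a,t]` with `z + c/2 ≤ f u` (`⊤` if there is none). -/
def hitAbove (f : ℝ → ℝ) (z c t : ℝ) (a : EReal) : EReal :=
  sInf ((fun u : ℝ => (u : EReal)) '' {u : ℝ | a ≤ (u : EReal) ∧ u ≤ t ∧ z + c / 2 ≤ f u})

/-- Infimum of the times `u ∈ [a,t]` with `f u < z - c/2` (`⊤` if there is none). -/
def hitBelow (f : ℝ → ℝ) (z c t : ℝ) (a : EReal) : EReal :=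
  sInf ((fun u : ℝ => (u : EReal)) '' {u : ℝ | a ≤ (u : EReal) ∧ u ≤ t ∧ f u < z - c / 2})

/-- The times `σ_n`: `σ_0 = s`, `τ_n = hitAbove σ_n`, `σ_{n+1} = hitBelow τ_n`. -/
def downcrossingTime (f : ℝ → ℝ) (z c s t : ℝ) : ℕ → EReal
  | 0 => (s : EReal)
  | n + 1 => hitBelow f z c t (hitAbove f z c t (downcrossingTime f z c s t n))

/-- Number of downcrossings of `[z - c/2, z + c/2]` by `f` on `[s,t]`: `max {n | σ_n ≤ t}`. -/
def downcrossings (f : ℝ → ℝ) (z c s t : ℝ) : ℕ :=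
  sSup {n : ℕ | downcrossingTime f z c s t n ≤ (t : EReal)}

/-- Number of upcrossings of `[z - c/2, z + c/2]` by `f` on `[s,t]`. -/
def upcrossings (f : ℝ → ℝ) (z c s t : ℝ) : ℕ :=
  downcrossings (fun u => -f u) (-z) c s t

/-- Number of crossings of `[z - c/2, z + c/2]` by `f` on `[s,t]`. -/
def crossings (f : ℝ → ℝ) (z c s t : ℝ) : ℕ :=
  upcrossings f z c s t + downcrossings f z c s t

/-- `L t z`, `t ∈ [0,1]`, is a local time of `f : [0,1] → ℝ` with respect to Lebesgue measure,
that is, a density of the occupation measure of `f` on `[0,t]`. -/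
structure IsLocalTime (f : ℝ → ℝ) (L : ℝ → ℝ → ℝ) : Prop where
  nonneg : ∀ t ∈ Icc (0 : ℝ) 1, ∀ z, 0 ≤ L t z
  measurable : ∀ t ∈ Icc (0 : ℝ) 1, Measurable (L t)
  integrable : ∀ t ∈ Icc (0 : ℝ) 1, Integrable (L t) volume
  occupation : ∀ t ∈ Icc (0 : ℝ) 1, ∀ g : ℝ → ℝ, Measurable g → (∃ B, ∀ z, |g z| ≤ B) →
    ∫ s in (0 : ℝ)..t, g (f s) = ∫ z, g z * L t z

/-- `3 ^ ⌊-log₃ p⌋`. -/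
def peanoScale (p : ℝ) : ℝ := (3 : ℝ) ^ ⌊-Real.logb 3 p⌋

/-- `C_p = 3^{⌊-log₃ p⌋} p (1 - (3/4) 3^{⌊-log₃ p⌋} p)`. -/
def peanoC (p : ℝ) : ℝ := peanoScale p * p * (1 - 3 / 4 * (peanoScale p * p))

/-- The normalization `φ(c) = c / C_c`. -/
def peanoPhi (c : ℝ) : ℝ := c / peanoC c

end

/-! ### Self-similarity of the Peano coordinate -/

/-! On each of the nine intervals of length 1/9 the curve x is a shifted copy of ±x scaled by 1/3
(`peanoX_subcell`), and this iterates to every level (`exists_peanoX_cell`). The central quantity is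
the integrated crossing number I(c) = ∫ n^{z,c}(x,[0,1]) dz, which equals C_c/c - c/4 for 0 < c ≤ 1.

If 1/3 < c ≤ 1, x never drops by more than 1/3, so at most one upcrossing is possible and I(c) = 1 -
c. If c ≤ 1/3, then in each third of the time interval x runs up, down and up across a column of
width 1/3. Crossings split without loss at these extremal turning points, and the column contributes
I(3c). The three columns follow each other in increasing order, and each of the two junctions adds
c, so I(c) = 3 I(3c) + 2c. Subadditivity of crossings gives the upper bound
(`integral_crossings_peanoX_le`). Explicit partitions obeying the same recursion give the lower
bound (`partitionSum_peanoX`), because partition sum ≤ truncated variation ≤ integrated crossings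
(`truncatedVariation_le_integral_crossings`). The same sandwich settles truncated variation.

For a weight g, cut [0,t] into cells of level m. On a cell g ∘ x oscillates little, and c times the
crossing mass is at most C_c/9^m. Cutting costs at most two crossings per cell, which is negligible
as c → 0 with m fixed. This bounds the weighted integral from above for nonnegative weights; applied
to B + g and B - g and compared with the lower bound for the total mass, it becomes two-sided
(`eventually_abs_crossings_sub_lt`). The crossing limits follow, using C_{3p} = C_p and C ≥ 1/4.

Finally x preserves Lebesgue measure (`map_peanoX`), so its occupation measures have densities, and
every local time integrates g to the time integral of g ∘ x. -/

theorem ofDigits_rev (d : ℕ → Fin 3) :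
    Real.ofDigits (fun n => (d n).rev) = 1 - Real.ofDigits d := by
  have h1 : Real.ofDigits (fun _ => (2 : Fin 3)) = 1 := Real.ofDigits_const_last_eq_one 2
  rw [eq_sub_iff_add_eq, ← h1]
  unfold Real.ofDigits
  rw [← Real.summable_ofDigitsTerm.tsum_add Real.summable_ofDigitsTerm]
  congr 1
  ext n
  simp only [Real.ofDigitsTerm]
  rw [← add_mul]
  congr 1
  generalize d n = k
  fin_cases k <;> norm_num [Fin.rev]

theorem ofDigits_iterate_rev (d : ℕ → Fin 3) {b : ℕ} (hb : b < 3) :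
    Real.ofDigits (fun n => Fin.rev^[b] (d n)) =
      if b = 1 then 1 - Real.ofDigits d else Real.ofDigits d := by
  interval_cases b
  · simp
  · simpa using ofDigits_rev d
  · simp

theorem digits_three_zero (a : ℕ) {b : ℕ} (hb : b < 3) {s : ℝ} (hs : s ∈ Ico (0 : ℝ) 1) :
    Real.digits ((3 * a + b + s) / 9) 3 0 = Fin.ofNat 3 a := by
  obtain ⟨h0, h1⟩ := hs
  have hb' : (b : ℝ) ≤ 2 := by exact_mod_cast Nat.le_of_lt_succ hb
  have hb0 : (0 : ℝ) ≤ b := b.cast_nonneg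
  unfold Real.digits
  congr 1
  rw [Nat.floor_eq_iff (by positivity)]
  push_cast
  constructor <;> linarith

theorem digits_three_succ (a b : ℕ) {s : ℝ} (hs : 0 ≤ s) (j : ℕ) :
    (Real.digits ((3 * a + b + s) / 9) 3 (j + 1) : ℕ) = (b * 3 ^ j + ⌊s * 3 ^ j⌋₊) % 3 := by
  have : (3 * a + b + s) / 9 * ((3 : ℕ) : ℝ) ^ (j + 1 + 1) =
      s * 3 ^ j + ((3 * a + b) * 3 ^ j : ℕ) := by
    push_cast; ring
  unfold Real.digits
  rw [this, Nat.floor_add_natCast (by positivity), Fin.val_ofNat]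
  rw [show ⌊s * 3 ^ j⌋₊ + (3 * a + b) * 3 ^ j =
    (b * 3 ^ j + ⌊s * 3 ^ j⌋₊) + 3 * (a * 3 ^ j) by ring, Nat.add_mul_mod_self_left]

theorem digits_three_one (a : ℕ) {b : ℕ} (hb : b < 3) {s : ℝ} (hs : s ∈ Ico (0 : ℝ) 1) :
    (Real.digits ((3 * a + b + s) / 9) 3 1 : ℕ) = b := by
  have := digits_three_succ a b hs.1 0
  rw [show (0 + 1 : ℕ) = 1 from rfl] at this
  rw [this]
  simp [Nat.floor_eq_zero.2 hs.2, Nat.mod_eq_of_lt hb]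

theorem digits_three_add_two (a b : ℕ) {s : ℝ} (hs : 0 ≤ s) (j : ℕ) :
    Real.digits ((3 * a + b + s) / 9) 3 (j + 2) = Real.digits s 3 j := by
  ext
  rw [digits_three_succ a b hs (j + 1)]
  rw [show b * 3 ^ (j + 1) + ⌊s * 3 ^ (j + 1)⌋₊ =
    ⌊s * 3 ^ (j + 1)⌋₊ + 3 * (b * 3 ^ j) by ring, Nat.add_mul_mod_self_left]
  simp [Real.digits]

theorem peanoX_mem_Icc (t : ℝ) : peanoX t ∈ Icc (0 : ℝ) 1 :=
  ⟨Real.ofDigits_nonneg _, Real.ofDigits_le_one _⟩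

theorem peanoX_one : peanoX 1 = 1 := by
  -- All digits of 1 are 2, so every exponent is even and the reversals cancel.
  have h : ∀ n, (Fin.rev^[∑ _i ∈ Finset.range n, 2]) (2 : Fin 3) = 2 := by
    intro n
    induction n with
    | zero => rfl
    | succ n ih =>
      rw [Finset.sum_range_succ, Function.iterate_add_apply]
      exact ih
  have h1 : Real.ofDigits (fun _ => (2 : Fin 3)) = 1 := Real.ofDigits_const_last_eq_one 2
  refine Eq.trans ?_ h1
  unfold peanoX
  congr 1
  ext n
  simp only [peanoDigit, if_true]
  exact congrArg Fin.val (h n)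

theorem peanoX_subcell_of_lt {a b : ℕ} (ha : a < 3) (hb : b < 3) {s : ℝ}
    (hs : s ∈ Ico (0 : ℝ) 1) :
    peanoX ((3 * a + b + s) / 9) = (a + if b = 1 then 1 - peanoX s else peanoX s) / 3 := by
  have hs1 : s ≠ 1 := hs.2.ne
  have ht1 : (3 * a + b + s) / 9 ≠ 1 := by
    have ha' : (a : ℝ) ≤ 2 := by exact_mod_cast Nat.le_of_lt_succ ha
    have hb' : (b : ℝ) ≤ 2 := by exact_mod_cast Nat.le_of_lt_succ hb
    have := hs.2
    intro h
    linarith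
  rw [peanoX, Real.ofDigits_eq_sum_add_ofDigits _ 1]
  have hd0 : peanoDigit ((3 * a + b + s) / 9) 0 = Fin.ofNat 3 a := by
    rw [peanoDigit, if_neg ht1, digits_three_zero a hb hs]
  have hd1 : (peanoDigit ((3 * a + b + s) / 9) 1 : ℕ) = b := by
    rw [peanoDigit, if_neg ht1, digits_three_one a hb hs]
  have hd : ∀ j, peanoDigit ((3 * a + b + s) / 9) (j + 2) = peanoDigit s j := by
    intro j
    rw [peanoDigit, peanoDigit, if_neg ht1, if_neg hs1, digits_three_add_two a b hs.1]
  have key : (fun n => (Fin.rev^[∑ i ∈ Finset.range (n + 1),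
      (peanoDigit ((3 * a + b + s) / 9) (2 * i + 1) : ℕ)])
        (peanoDigit ((3 * a + b + s) / 9) (2 * (n + 1)))) =
      fun n => Fin.rev^[b] ((Fin.rev^[∑ i ∈ Finset.range n, (peanoDigit s (2 * i + 1) : ℕ)])
        (peanoDigit s (2 * n))) := by
    funext n
    rw [← Function.iterate_add_apply, Finset.sum_range_succ', mul_zero, zero_add, hd1,
      show 2 * (n + 1) = 2 * n + 2 by ring, hd, add_comm b]
    simp only [show ∀ i, 2 * (i + 1) + 1 = 2 * i + 1 + 2 by intro i; ring, hd]
  rw [key, ofDigits_iterate_rev _ hb]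
  simp only [Finset.range_one, Finset.sum_singleton, Real.ofDigitsTerm, Finset.range_zero,
    Finset.sum_empty, Function.iterate_zero, id, mul_zero, hd0, Fin.val_ofNat,
    Nat.mod_eq_of_lt ha]
  change _ + _ * (if b = 1 then 1 - peanoX s else peanoX s) = _
  push_cast
  ring

theorem peanoX_zero : peanoX 0 = 0 := by
  have := peanoX_subcell_of_lt (a := 0) (b := 0) (by norm_num) (by norm_num)
    (s := 0) (by norm_num)
  norm_num at this
  linarith

/-- The value s = 1 is the start of the next cell, where the half-open formula at s = 0 applies;
agreement of the two expressions is the independence of x from the chosen ternary expansion. The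
last cell ends at 1, where the digit convention gives x = 1. -/
theorem peanoX_subcell {a b : ℕ} (ha : a < 3) (hb : b < 3) {s : ℝ} (hs : s ∈ Icc (0 : ℝ) 1) :
    peanoX ((3 * a + b + s) / 9) = (a + if b = 1 then 1 - peanoX s else peanoX s) / 3 := by
  rcases hs.2.lt_or_eq with h | rfl
  · exact peanoX_subcell_of_lt ha hb ⟨hs.1, h⟩
  have h0 : (0 : ℝ) ∈ Ico (0 : ℝ) 1 := by norm_num
  by_cases hb2 : b + 1 < 3
  · have := peanoX_subcell_of_lt ha hb2 h0
    rw [show (3 * a + b + 1 : ℝ) / 9 = (3 * a + (b + 1 : ℕ) + 0) / 9 by push_cast; ring, this,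
      peanoX_zero, peanoX_one]
    obtain rfl | rfl : b = 0 ∨ b = 1 := by omega
    all_goals norm_num
  obtain rfl : b = 2 := by omega
  by_cases ha2 : a + 1 < 3
  · have := peanoX_subcell_of_lt ha2 (b := 0) (by norm_num) h0
    rw [show (3 * a + (2 : ℕ) + 1 : ℝ) / 9 = (3 * (a + 1 : ℕ) + (0 : ℕ) + 0) / 9 by
      push_cast; ring, this, peanoX_zero, peanoX_one]
    norm_num
  obtain rfl : a = 2 := by omega
  norm_num [peanoX_one]

/-- On the `i`-th interval of length `9⁻ᵐ` the Peano coordinate is an affine image of itself with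
scaling factor `ε 3⁻ᵐ`, `ε = ±1`. -/
theorem exists_peanoX_cell (m : ℕ) : ∀ i : ℕ, i < 9 ^ m → ∃ A ε : ℝ, (ε = 1 ∨ ε = -1) ∧
    ∀ s ∈ Icc (0 : ℝ) 1, peanoX ((i + s) / 9 ^ m) = A + ε * (1 / 3) ^ m * peanoX s := by
  induction m with
  | zero =>
    intro i hi
    obtain rfl : i = 0 := by simpa using hi
    exact ⟨0, 1, Or.inl rfl, fun s _ => by simp⟩
  | succ m ih =>
    intro i hi
    have hq : i / 9 < 9 ^ m := by rw [pow_succ] at hi; omega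
    obtain ⟨A, ε, hε, h⟩ := ih _ hq
    have ha : i % 9 / 3 < 3 := by omega
    have hb : i % 3 < 3 := by omega
    have hi' : (i : ℝ) = 9 * (i / 9 : ℕ) + (3 * (i % 9 / 3 : ℕ) + (i % 3 : ℕ)) := by
      exact_mod_cast (show i = 9 * (i / 9) + (3 * (i % 9 / 3) + i % 3) by omega)
    have hstep : ∀ s ∈ Icc (0 : ℝ) 1, peanoX ((i + s) / 9 ^ (m + 1)) =
        A + ε * (1 / 3) ^ m * (((i % 9 / 3 : ℕ) +
          if i % 3 = 1 then 1 - peanoX s else peanoX s) / 3) := by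
      intro s hs
      have ha' : ((i % 9 / 3 : ℕ) : ℝ) ≤ 2 := by exact_mod_cast Nat.le_of_lt_succ ha
      have hb' : ((i % 3 : ℕ) : ℝ) ≤ 2 := by exact_mod_cast Nat.le_of_lt_succ hb
      have := hs.1
      have := hs.2
      rw [← peanoX_subcell ha hb hs, ← h _ ⟨by positivity, by linarith⟩]
      congr 1
      rw [hi', pow_succ]
      field_simp
      ring
    by_cases hb1 : i % 3 = 1
    · refine ⟨A + ε * (1 / 3) ^ m * (((i % 9 / 3 : ℕ) + 1) / 3), -ε, ?_, fun s hs => ?_⟩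
      · rcases hε with rfl | rfl <;> simp
      · rw [hstep s hs, if_pos hb1]; ring
    · refine ⟨A + ε * (1 / 3) ^ m * ((i % 9 / 3 : ℕ) / 3), ε, hε, fun s hs => ?_⟩
      rw [hstep s hs, if_neg hb1]; ring

theorem exists_nat_add_mem_Icc {M : ℕ} (hM : 0 < M) {w : ℝ} (hw : w ∈ Icc (0 : ℝ) M) :
    ∃ i : ℕ, i < M ∧ w - i ∈ Icc (0 : ℝ) 1 := by
  rcases hw.2.lt_or_eq with h | rfl
  · exact ⟨⌊w⌋₊, (Nat.floor_lt hw.1).2 h, by linarith [Nat.floor_le hw.1],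
      by linarith [Nat.lt_floor_add_one w]⟩
  · refine ⟨M - 1, by omega, ?_⟩
    rw [Nat.cast_sub (by omega)]
    norm_num

/-! ### Columns, cells and continuity. -/

theorem peanoX_mem_column {a : ℕ} (ha : a < 3) {t : ℝ}
    (ht : t ∈ Icc ((a : ℝ) / 3) ((a + 1) / 3)) :
    peanoX t ∈ Icc ((a : ℝ) / 3) ((a + 1) / 3) := by
  obtain ⟨b, hb, hs⟩ := exists_nat_add_mem_Icc (M := 3) (by norm_num) (w := 9 * t - 3 * a)
    ⟨by linarith [ht.1], by push_cast; linarith [ht.2]⟩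
  have h := peanoX_subcell ha hb hs
  rw [show (3 * a + b + (9 * t - 3 * a - b)) / 9 = t by ring] at h
  obtain ⟨h0, h1⟩ := peanoX_mem_Icc (9 * t - 3 * a - b)
  rw [h]
  split_ifs <;> constructor <;> linarith

/-- Each third of the time interval is mapped into the corresponding third of the range, so a drop
can only occur inside one column. -/
theorem peanoX_sub_le_third {u v : ℝ} (hu : 0 ≤ u) (huv : u ≤ v) (hv : v ≤ 1) :
    peanoX u - peanoX v ≤ 1 / 3 := by
  obtain ⟨a, ha, hs⟩ := exists_nat_add_mem_Icc (M := 3) (by norm_num) (w := 3 * u)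
    ⟨by linarith, by push_cast; linarith⟩
  obtain ⟨b, hb, hr⟩ := exists_nat_add_mem_Icc (M := 3) (by norm_num) (w := 3 * v)
    ⟨by linarith, by push_cast; linarith⟩
  have hxu := peanoX_mem_column ha (t := u) ⟨by linarith [hs.1], by linarith [hs.2]⟩
  have hxv := peanoX_mem_column hb (t := v) ⟨by linarith [hr.1], by linarith [hr.2]⟩
  by_cases hab : a ≤ b
  · have : (a : ℝ) ≤ b := by exact_mod_cast hab
    linarith [hxu.2, hxv.1]
  · have : (b : ℝ) + 1 ≤ a := by exact_mod_cast Nat.lt_of_not_le hab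
    have huv' : u = v := by linarith [hs.1, hr.2]
    rw [huv']
    norm_num

/-- The `m`-th level cell with number `i`. -/
def peanoCell (m i : ℕ) : Set ℝ := Icc ((i : ℝ) / 9 ^ m) ((i + 1) / 9 ^ m)

theorem mem_peanoCell_iff {m i : ℕ} {t : ℝ} :
    t ∈ peanoCell m i ↔ 9 ^ m * t - i ∈ Icc (0 : ℝ) 1 := by
  have h9 : (0 : ℝ) < 9 ^ m := by positivity
  rw [peanoCell, mem_Icc, mem_Icc, div_le_iff₀ h9, le_div_iff₀ h9]
  constructor <;> rintro ⟨h1, h2⟩ <;> constructor <;> linarith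

theorem peanoCell_subset {m i : ℕ} (hi : i < 9 ^ m) : peanoCell m i ⊆ Icc 0 1 := by
  intro t ht
  refine ⟨le_trans (by positivity) ht.1, ht.2.trans ?_⟩
  rw [div_le_one (by positivity)]
  exact_mod_cast hi

theorem abs_peanoX_sub_le_of_mem_cell {m i : ℕ} (hi : i < 9 ^ m) {u v : ℝ}
    (hu : u ∈ peanoCell m i) (hv : v ∈ peanoCell m i) :
    |peanoX u - peanoX v| ≤ (1 / 3) ^ m := by
  obtain ⟨A, ε, hε, h⟩ := exists_peanoX_cell m i hi
  have hu' := h _ (mem_peanoCell_iff.1 hu)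
  have hv' := h _ (mem_peanoCell_iff.1 hv)
  have key : ∀ t : ℝ, (i + (9 ^ m * t - i)) / 9 ^ m = t := fun t => by field_simp; ring
  rw [key] at hu' hv'
  rw [hu', hv', show ∀ p q : ℝ, A + ε * (1 / 3) ^ m * p - (A + ε * (1 / 3) ^ m * q) =
    ε * ((1 / 3) ^ m * (p - q)) by intros; ring, abs_mul, abs_mul,
    abs_of_pos (by positivity : (0 : ℝ) < (1 / 3) ^ m)]
  have hp := peanoX_mem_Icc (9 ^ m * u - i)
  have hq := peanoX_mem_Icc (9 ^ m * v - i)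
  have : |peanoX (9 ^ m * u - i) - peanoX (9 ^ m * v - i)| ≤ 1 := by
    rw [abs_le]; constructor <;> linarith [hp.1, hp.2, hq.1, hq.2]
  have he : |ε| = 1 := by rcases hε with rfl | rfl <;> simp
  rw [he, one_mul]
  exact mul_le_of_le_one_right (by positivity) this

theorem exists_mem_peanoCell (m : ℕ) {t : ℝ} (ht : t ∈ Icc (0 : ℝ) 1) :
    ∃ i, i < 9 ^ m ∧ t ∈ peanoCell m i := by
  obtain ⟨i, hi, h⟩ := exists_nat_add_mem_Icc (M := 9 ^ m) (by positivity) (w := 9 ^ m * t)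
    ⟨mul_nonneg (by positivity) ht.1, by
      push_cast; exact mul_le_of_le_one_right (by positivity) ht.2⟩
  exact ⟨i, hi, mem_peanoCell_iff.2 h⟩

/-- Times this close lie in the same cell or in two adjacent ones, and adjacent cells share an
endpoint. -/
theorem abs_peanoX_sub_le_of_close {m : ℕ} {u v : ℝ} (hu : 0 ≤ u) (huv : u ≤ v) (hv : v ≤ 1)
    (hc : v ≤ u + 1 / 9 ^ m) : |peanoX u - peanoX v| ≤ 2 * (1 / 3) ^ m := by
  have h3 : (0 : ℝ) < (1 / 3) ^ m := by positivity
  have h9 : (0 : ℝ) < 9 ^ m := by positivity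
  obtain ⟨i, hi, hui⟩ := exists_mem_peanoCell m ⟨hu, huv.trans hv⟩
  by_cases hvi : v ≤ (i + 1) / 9 ^ m
  · have := abs_peanoX_sub_le_of_mem_cell hi hui ⟨hui.1.trans huv, hvi⟩
    linarith
  · push Not at hvi
    have hi1 : i + 1 < 9 ^ m := by
      have : (i + 1 : ℝ) / 9 ^ m < 1 := hvi.trans_le hv
      rw [div_lt_one h9] at this
      exact_mod_cast this
    have hp : ((i : ℝ) + 1) / 9 ^ m ∈ peanoCell m i :=
      ⟨by gcongr; linarith, le_rfl⟩
    have hq : ((i : ℝ) + 1) / 9 ^ m ∈ peanoCell m (i + 1) :=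
      ⟨by push_cast; exact le_rfl, by push_cast; gcongr; linarith⟩
    have hv' : v ∈ peanoCell m (i + 1) := by
      refine ⟨by push_cast; exact hvi.le, ?_⟩
      have := hui.2
      push_cast
      rw [add_div _ 1]
      linarith
    have h1 := abs_peanoX_sub_le_of_mem_cell hi hui hp
    have h2 := abs_peanoX_sub_le_of_mem_cell hi1 hq hv'
    linarith [abs_sub_le (peanoX u) (peanoX ((i + 1) / 9 ^ m)) (peanoX v)]

theorem continuousOn_peanoX : ContinuousOn peanoX (Icc 0 1) := by
  rw [Metric.continuousOn_iff]
  intro v hv ε hε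
  obtain ⟨m, hm⟩ := exists_pow_lt_of_lt_one (half_pos hε) (show (1 / 3 : ℝ) < 1 by norm_num)
  refine ⟨1 / 9 ^ m, by positivity, fun u hu huv => ?_⟩
  rw [Real.dist_eq] at huv ⊢
  rw [abs_lt] at huv
  rcases le_total u v with h | h
  · linarith [abs_peanoX_sub_le_of_close (m := m) hu.1 h hv.2 (by linarith)]
  · rw [abs_sub_comm]
    linarith [abs_peanoX_sub_le_of_close (m := m) hv.1 h hu.2 (by linarith)]

/-! ### Downcrossings as alternating chains -/

/-- `DownChain f lo hi b a n`: there are times `a ≤ u₁ ≤ v₁ ≤ … ≤ uₙ ≤ vₙ ≤ b` with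
`hi ≤ f uᵢ` and `f vᵢ < lo`. -/
inductive DownChain (f : ℝ → ℝ) (lo hi b : ℝ) : ℝ → ℕ → Prop
  | zero {a : ℝ} : a ≤ b → DownChain f lo hi b a 0
  | succ {a u v : ℝ} {n : ℕ} : a ≤ u → u ≤ v → hi ≤ f u → f v < lo →
      DownChain f lo hi b v n → DownChain f lo hi b a (n + 1)

namespace DownChain

variable {f : ℝ → ℝ} {lo hi a b s : ℝ} {n m : ℕ}

theorem le (h : DownChain f lo hi b a n) : a ≤ b := by
  induction h with
  | zero h => exact h
  | succ h1 h2 _ _ _ ih => exact h1.trans (h2.trans ih)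

theorem mono_left (h : DownChain f lo hi b s n) (has : a ≤ s) : DownChain f lo hi b a n := by
  cases h with
  | zero h => exact .zero (has.trans h)
  | succ h1 h2 h3 h4 h5 => exact .succ (has.trans h1) h2 h3 h4 h5

theorem mono_right (h : DownChain f lo hi s a n) (hsb : s ≤ b) : DownChain f lo hi b a n := by
  induction h with
  | zero h => exact .zero (h.trans hsb)
  | succ h1 h2 h3 h4 _ ih => exact .succ h1 h2 h3 h4 ih

theorem append (h : DownChain f lo hi s a n) (h' : DownChain f lo hi b s m) :
    DownChain f lo hi b a (m + n) := by
  induction h with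
  | zero h => exact h'.mono_left h
  | succ h1 h2 h3 h4 _ ih => exact .succ h1 h2 h3 h4 ih

theorem pred (h : DownChain f lo hi b a (n + 1)) : DownChain f lo hi b a n := by
  cases h with
  | succ h1 h2 _ _ h5 => exact h5.mono_left (h1.trans h2)

theorem of_le (h : DownChain f lo hi b a n) (hmn : m ≤ n) : DownChain f lo hi b a m := by
  induction n, hmn using Nat.le_induction with
  | base => exact h
  | succ k _ ih => exact ih h.pred

theorem map {g : ℝ → ℝ} {lo' hi' b' : ℝ} {φ : ℝ → ℝ} (h : DownChain f lo hi b a n)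
    (hφ : ∀ u v, a ≤ u → u ≤ v → v ≤ b → φ u ≤ φ v) (hφb : φ b ≤ b')
    (hhi : ∀ u ∈ Icc a b, hi ≤ f u → hi' ≤ g (φ u))
    (hlo : ∀ u ∈ Icc a b, f u < lo → g (φ u) < lo') : DownChain g lo' hi' b' (φ a) n := by
  induction h with
  | zero h => exact .zero ((hφ _ _ le_rfl h le_rfl).trans hφb)
  | @succ a u v n h1 h2 h3 h4 h5 ih =>
    have hvb := h5.le
    have hav := h1.trans h2
    exact .succ (hφ _ _ le_rfl h1 (h2.trans hvb)) (hφ _ _ h1 h2 hvb)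
      (hhi u ⟨h1, h2.trans hvb⟩ h3) (hlo v ⟨hav, hvb⟩ h4)
      (ih (fun p q hp => hφ p q (hav.trans hp)) (fun p hp => hhi p ⟨hav.trans hp.1, hp.2⟩)
        fun p hp => hlo p ⟨hav.trans hp.1, hp.2⟩)

/-- Splitting a chain at `s` loses at most one downcrossing, and none unless there are
`u ≤ s ≤ v` with `hi ≤ f u` and `f v < lo` such that `f s` is strictly within the band. -/
theorem split (h : DownChain f lo hi b a n) (has : a ≤ s) (hsb : s ≤ b) :
    ∃ k l, DownChain f lo hi s a k ∧ DownChain f lo hi b s l ∧ n ≤ k + l + 1 ∧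
      ((∀ u v, a ≤ u → u ≤ s → s ≤ v → v ≤ b → hi ≤ f u → f v < lo → hi ≤ f s ∨ f s < lo) →
        n ≤ k + l) := by
  induction h with
  | zero h => exact ⟨0, 0, .zero has, .zero hsb, by simp, by simp⟩
  | @succ a u v n h1 h2 h3 h4 h5 ih =>
    by_cases hvs : v ≤ s
    · obtain ⟨k, l, hk, hl, hn, hn'⟩ := ih hvs
      refine ⟨k + 1, l, .succ h1 h2 h3 h4 hk, hl, by omega, fun H => ?_⟩
      have := hn' fun p q hp => H p q (h1.trans (h2.trans hp))
      omega
    push Not at hvs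
    by_cases hus : s ≤ u
    · exact ⟨0, n + 1, .zero has, .succ hus h2 h3 h4 h5, by omega, fun _ => by omega⟩
    push Not at hus
    by_cases H : hi ≤ f s
    · exact ⟨0, n + 1, .zero has, .succ le_rfl hvs.le H h4 h5, by omega, fun _ => by omega⟩
    by_cases H' : f s < lo
    · exact ⟨1, n, .succ h1 hus.le h3 H' (.zero le_rfl), h5.mono_left hvs.le, by omega,
        fun _ => by omega⟩
    -- Here f s lies in the band, so the single downcrossing from u to v straddling s is given up.
    · refine ⟨0, n, .zero has, h5.mono_left hvs.le, by omega, fun K => ?_⟩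
      rcases K u v h1 hus.le hvs.le h5.le h3 h4 with h | h
      · exact absurd h H
      · exact absurd h H'

/-- Every downcrossing consumes time at least δ; with uniform continuity this bounds their number.
-/
theorem mul_le {δ : ℝ} (h : DownChain f lo hi b a n)
    (hδ : ∀ u ∈ Icc a b, ∀ v ∈ Icc a b, hi ≤ f u → f v < lo → δ ≤ |u - v|) :
    n * δ ≤ b - a := by
  induction h with
  | zero h => simpa using h
  | @succ a u v n h1 h2 h3 h4 h5 ih =>
    have hav := h1.trans h2
    have hvb := h5.le
    have h := ih fun p hp q hq => hδ p ⟨hav.trans hp.1, hp.2⟩ q ⟨hav.trans hq.1, hq.2⟩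
    have := hδ u ⟨h1, h2.trans hvb⟩ v ⟨hav, hvb⟩ h3 h4
    rw [abs_of_nonpos (by linarith)] at this
    push_cast
    linarith

end DownChain

/-! ### Stopping times versus chains. -/

section Crossings

variable {f : ℝ → ℝ} {z c a b s : ℝ}

/-- The stopping times are greedy: none comes later than the corresponding time of any chain. -/
theorem downcrossingTime_add_le {k n : ℕ} (h : DownChain f (z - c / 2) (z + c / 2) b s n)
    (hk : downcrossingTime f z c a b k ≤ (s : EReal)) :
    downcrossingTime f z c a b (n + k) ≤ (b : EReal) := by
  induction h generalizing k with
  | zero h => simpa using hk.trans (EReal.coe_le_coe_iff.2 h)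
  | @succ s u v n h1 h2 h3 h4 h5 ih =>
    have hvb := h5.le
    have hτ : hitAbove f z c b (downcrossingTime f z c a b k) ≤ (u : EReal) :=
      sInf_le ⟨u, ⟨hk.trans (EReal.coe_le_coe_iff.2 h1), h2.trans hvb, h3⟩, rfl⟩
    have hσ : downcrossingTime f z c a b (k + 1) ≤ (v : EReal) :=
      sInf_le ⟨v, ⟨hτ.trans (EReal.coe_le_coe_iff.2 h2), hvb, h4⟩, rfl⟩
    rw [show n + 1 + k = n + (k + 1) by ring]
    exact ih hσ

theorem sInf_image_coe_eReal {S : Set ℝ} (hne : S.Nonempty) (hbd : BddBelow S) :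
    sInf ((fun u : ℝ => (u : EReal)) '' S) = ((sInf S : ℝ) : EReal) := by
  apply le_antisymm
  · refine le_of_forall_gt fun y hy => ?_
    obtain ⟨r, hr, hry⟩ := EReal.lt_iff_exists_real_btwn.1 hy
    obtain ⟨u, hu, hur⟩ := exists_lt_of_csInf_lt hne (EReal.coe_lt_coe_iff.1 hr)
    exact (sInf_le (mem_image_of_mem _ hu)).trans_lt ((EReal.coe_lt_coe_iff.2 hur).trans hry)
  · refine le_sInf ?_
    rintro _ ⟨u, hu, rfl⟩
    exact EReal.coe_le_coe_iff.2 (csInf_le hbd hu)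

theorem nonempty_of_sInf_image_coe_le {S : Set ℝ} {b : ℝ}
    (h : sInf ((fun u : ℝ => (u : EReal)) '' S) ≤ (b : EReal)) : S.Nonempty := by
  by_contra hS
  rw [not_nonempty_iff_eq_empty] at hS
  simp [hS] at h

/-- The time σ_n is an infimum over a strict inequality and need not be attained. A chain can
therefore only be required to end arbitrarily soon after σ_n. -/
theorem exists_downChain_near_downcrossingTime (hf : ContinuousOn f (Icc a b)) (hab : a ≤ b)
    (hc : 0 < c) (n : ℕ) (hn : downcrossingTime f z c a b n ≤ (b : EReal)) :
    ∃ σ ∈ Icc a b, downcrossingTime f z c a b n = (σ : EReal) ∧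
      (n = 0 ∨ f σ ≤ z - c / 2) ∧
      ∀ ε > 0, ∃ v ∈ Icc σ b, v < σ + ε ∧ DownChain f (z - c / 2) (z + c / 2) v a n := by
  induction n with
  | zero =>
    exact ⟨a, ⟨le_rfl, hab⟩, rfl, Or.inl rfl, fun ε hε => ⟨a, ⟨le_rfl, hab⟩, by linarith,
      .zero le_rfl⟩⟩
  | succ n ih =>
    obtain ⟨w, hw, hwb, hwlo⟩ := nonempty_of_sInf_image_coe_le hn
    have hτw : hitAbove f z c b (downcrossingTime f z c a b n) ≤ (w : EReal) := hw
    obtain ⟨y, hy, hyb, hyhi⟩ := nonempty_of_sInf_image_coe_le hτw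
    obtain ⟨σ, hσ, hσe, hσlo, hσn⟩ := ih (hy.trans (EReal.coe_le_coe_iff.2 hyb))
    have hTset : {u : ℝ | downcrossingTime f z c a b n ≤ (u : EReal) ∧ u ≤ b ∧ z + c / 2 ≤ f u} =
        Icc σ b ∩ f ⁻¹' Ici (z + c / 2) := by
      ext u
      simp [hσe, and_assoc]
    have hTcl : IsClosed (Icc σ b ∩ f ⁻¹' Ici (z + c / 2)) :=
      (hf.mono (Icc_subset_Icc_left hσ.1)).preimage_isClosed_of_isClosed isClosed_Icc isClosed_Ici
    have hTne : (Icc σ b ∩ f ⁻¹' Ici (z + c / 2)).Nonempty := ⟨y, by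
      rw [← hTset]; exact ⟨hy, hyb, hyhi⟩⟩
    have hTbd : BddBelow (Icc σ b ∩ f ⁻¹' Ici (z + c / 2)) := ⟨σ, fun u hu => hu.1.1⟩
    set τ := sInf (Icc σ b ∩ f ⁻¹' Ici (z + c / 2)) with hτ
    obtain ⟨⟨hστ, hτb⟩, hτhi⟩ : τ ∈ Icc σ b ∩ f ⁻¹' Ici (z + c / 2) :=
      hTcl.csInf_mem hTne hTbd
    have hτe : hitAbove f z c b (downcrossingTime f z c a b n) = (τ : EReal) := by
      rw [hitAbove, hTset, sInf_image_coe_eReal hTne hTbd]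
    obtain ⟨v₀, hv₀τ, hchain⟩ : ∃ v ≤ τ, DownChain f (z - c / 2) (z + c / 2) v a n := by
      rcases hσlo with rfl | hσlo
      · exact ⟨a, hσ.1.trans hστ, .zero le_rfl⟩
      -- At σ the function is at or below the band and at τ at or above it; since c > 0 there is
      -- room between them for the end of the previous chain.
      · have hne : σ ≠ τ := by
          intro h
          rw [← h] at hτhi
          have : z + c / 2 ≤ f σ := hτhi
          linarith
        have hlt : σ < τ := lt_of_le_of_ne hστ hne
        obtain ⟨v, _, hv, hch⟩ := hσn (τ - σ) (by linarith)
        exact ⟨v, by linarith, hch⟩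
    have hSset : {u : ℝ | hitAbove f z c b (downcrossingTime f z c a b n) ≤ (u : EReal) ∧
        u ≤ b ∧ f u < z - c / 2} = Icc τ b ∩ f ⁻¹' Iio (z - c / 2) := by
      ext u
      simp [hτe, and_assoc]
    have hSne : (Icc τ b ∩ f ⁻¹' Iio (z - c / 2)).Nonempty := ⟨w, by
      rw [← hSset]; exact ⟨hτw, hwb, hwlo⟩⟩
    have hSbd : BddBelow (Icc τ b ∩ f ⁻¹' Iio (z - c / 2)) := ⟨τ, fun u hu => hu.1.1⟩
    set σ' := sInf (Icc τ b ∩ f ⁻¹' Iio (z - c / 2)) with hσ'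
    have hτσ' : τ ≤ σ' := le_csInf hSne fun u hu => hu.1.1
    have hσ'b : σ' ≤ b := (csInf_le hSbd hSne.some_mem).trans hSne.some_mem.1.2
    have haτ : a ≤ τ := hσ.1.trans hστ
    refine ⟨σ', ⟨haτ.trans hτσ', hσ'b⟩, ?_, Or.inr ?_, fun ε hε => ?_⟩
    · rw [downcrossingTime, hitBelow, hSset, sInf_image_coe_eReal hSne hSbd]
    · have hcl : σ' ∈ closure (Icc τ b ∩ f ⁻¹' Iio (z - c / 2)) := csInf_mem_closure hSne hSbd
      have hcl' : IsClosed (Icc τ b ∩ f ⁻¹' Iic (z - c / 2)) :=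
        (hf.mono (Icc_subset_Icc_left haτ)).preimage_isClosed_of_isClosed isClosed_Icc isClosed_Iic
      have := closure_minimal (s := Icc τ b ∩ f ⁻¹' Iio (z - c / 2))
        (t := Icc τ b ∩ f ⁻¹' Iic (z - c / 2))
        (fun u hu => ⟨hu.1, (show f u < z - c / 2 from hu.2).le⟩) hcl' hcl
      exact this.2
    · obtain ⟨v, hv, hvlt⟩ := exists_lt_of_csInf_lt hSne (show σ' < σ' + ε by linarith)
      refine ⟨v, ⟨csInf_le hSbd hv, hv.1.2⟩, hvlt, ?_⟩
      have := hchain.append (m := 1) (b := v)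
        (.succ hv₀τ hv.1.1 hτhi hv.2 (.zero le_rfl))
      rwa [add_comm 1 n] at this

theorem downcrossingTime_le_iff (hf : ContinuousOn f (Icc a b)) (hab : a ≤ b) (hc : 0 < c)
    (n : ℕ) : downcrossingTime f z c a b n ≤ (b : EReal) ↔
      DownChain f (z - c / 2) (z + c / 2) b a n := by
  refine ⟨fun h => ?_, fun h => downcrossingTime_add_le (k := 0) h le_rfl⟩
  obtain ⟨σ, _, _, _, h⟩ := exists_downChain_near_downcrossingTime hf hab hc n h
  obtain ⟨v, hv, _, hch⟩ := h 1 one_pos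
  exact hch.mono_right hv.2

theorem exists_downChain_bound (hf : ContinuousOn f (Icc a b)) (hc : 0 < c) :
    ∃ K : ℕ, ∀ z n, DownChain f (z - c / 2) (z + c / 2) b a n → n ≤ K := by
  have huc := isCompact_Icc.uniformContinuousOn_of_continuous hf
  rw [Metric.uniformContinuousOn_iff] at huc
  obtain ⟨δ, hδ, h⟩ := huc c hc
  refine ⟨⌈(b - a) / δ⌉₊, fun z n hn => ?_⟩
  have := hn.mul_le (δ := δ) fun u hu v hv h1 h2 => by
    by_contra! hlt
    have := h u hu v hv hlt
    rw [Real.dist_eq] at this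
    linarith [le_abs_self (f u - f v)]
  have h1 : (n : ℝ) ≤ (b - a) / δ := by rwa [le_div_iff₀ hδ]
  exact_mod_cast h1.trans (Nat.le_ceil _)

theorem le_downcrossings_iff (hf : ContinuousOn f (Icc a b)) (hab : a ≤ b) (hc : 0 < c) {n : ℕ} :
    n ≤ downcrossings f z c a b ↔ DownChain f (z - c / 2) (z + c / 2) b a n := by
  have hset : {n : ℕ | downcrossingTime f z c a b n ≤ (b : EReal)} =
      {n | DownChain f (z - c / 2) (z + c / 2) b a n} := by
    ext n
    exact downcrossingTime_le_iff hf hab hc n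
  -- On ℕ the `sSup` of an unbounded set is 0, so boundedness is essential here.
  obtain ⟨K, hK⟩ := exists_downChain_bound (f := f) (a := a) (b := b) hf hc
  have hbd : BddAbove {n | DownChain f (z - c / 2) (z + c / 2) b a n} := ⟨K, fun n => hK z n⟩
  rw [downcrossings, hset]
  refine ⟨fun h => ?_, fun h => le_csSup hbd h⟩
  have hmem := Nat.sSup_mem (s := {n | DownChain f (z - c / 2) (z + c / 2) b a n})
    ⟨0, .zero hab⟩ hbd
  exact DownChain.of_le hmem h

end Crossings

/-! ### Splitting crossing numbers in time. -/

section Crossings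

variable {f : ℝ → ℝ} {z c a b s : ℝ}

theorem downcrossings_le_of_map {g : ℝ → ℝ} {z' c' a' b' : ℝ} (hf : ContinuousOn f (Icc a b))
    (hab : a ≤ b) (hc : 0 < c) (hg : ContinuousOn g (Icc a' b')) (hab' : a' ≤ b') (hc' : 0 < c')
    {φ : ℝ → ℝ} (hφ : ∀ u v, a ≤ u → u ≤ v → v ≤ b → φ u ≤ φ v) (hφa : a' ≤ φ a) (hφb : φ b ≤ b')
    (hhi : ∀ u ∈ Icc a b, z + c / 2 ≤ f u → z' + c' / 2 ≤ g (φ u))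
    (hlo : ∀ u ∈ Icc a b, f u < z - c / 2 → g (φ u) < z' - c' / 2) :
    downcrossings f z c a b ≤ downcrossings g z' c' a' b' := by
  rw [le_downcrossings_iff hg hab' hc']
  exact (((le_downcrossings_iff hf hab hc).1 le_rfl).map hφ hφb hhi hlo).mono_left hφa

theorem downcrossings_mono_right (hf : ContinuousOn f (Icc a b)) (has : a ≤ s) (hsb : s ≤ b)
    (hc : 0 < c) : downcrossings f z c a s ≤ downcrossings f z c a b :=
  downcrossings_le_of_map (hf.mono (Icc_subset_Icc_right hsb)) has hc hf (has.trans hsb) hc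
    (φ := id) (fun _ _ _ h _ => h) le_rfl hsb (fun _ _ h => h) fun _ _ h => h

theorem crossings_mono_right (hf : ContinuousOn f (Icc a b)) (has : a ≤ s) (hsb : s ≤ b)
    (hc : 0 < c) : crossings f z c a s ≤ crossings f z c a b :=
  add_le_add (downcrossings_mono_right hf.neg has hsb hc) (downcrossings_mono_right hf has hsb hc)

theorem downcrossings_le_add_one (hf : ContinuousOn f (Icc a b)) (has : a ≤ s) (hsb : s ≤ b)
    (hc : 0 < c) :
    downcrossings f z c a b ≤ downcrossings f z c a s + downcrossings f z c s b + 1 := by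
  obtain ⟨k, l, hk, hl, hn, -⟩ :=
    ((le_downcrossings_iff hf (has.trans hsb) hc (z := z)).1 le_rfl).split has hsb
  have hk' := (le_downcrossings_iff (hf.mono (Icc_subset_Icc_right hsb)) has hc).2 hk
  have hl' := (le_downcrossings_iff (hf.mono (Icc_subset_Icc_left has)) hsb hc).2 hl
  omega

theorem downcrossings_le_add (hf : ContinuousOn f (Icc a b)) (has : a ≤ s) (hsb : s ≤ b)
    (hc : 0 < c) (H : ∀ u ∈ Icc a s, ∀ v ∈ Icc s b, z + c / 2 ≤ f u → f v < z - c / 2 →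
      z + c / 2 ≤ f s ∨ f s < z - c / 2) :
    downcrossings f z c a b ≤ downcrossings f z c a s + downcrossings f z c s b := by
  obtain ⟨k, l, hk, hl, -, hn⟩ :=
    ((le_downcrossings_iff hf (has.trans hsb) hc (z := z)).1 le_rfl).split has hsb
  have hk' := (le_downcrossings_iff (hf.mono (Icc_subset_Icc_right hsb)) has hc).2 hk
  have hl' := (le_downcrossings_iff (hf.mono (Icc_subset_Icc_left has)) hsb hc).2 hl
  have := hn fun u v h1 h2 h3 h4 => H u ⟨h1, h2⟩ v ⟨h3, h4⟩
  omega

theorem crossings_le_add_two (hf : ContinuousOn f (Icc a b)) (has : a ≤ s) (hsb : s ≤ b)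
    (hc : 0 < c) :
    crossings f z c a b ≤ crossings f z c a s + crossings f z c s b + 2 := by
  have h1 := downcrossings_le_add_one (z := z) hf has hsb hc
  have h2 := downcrossings_le_add_one (z := -z) hf.neg has hsb hc
  unfold crossings _root_.upcrossings
  simp only [Pi.neg_def] at h2
  omega

/-- A crossing in either direction that straddles a global maximum has its upper end witnessed at s
itself, so cutting there loses nothing. -/
theorem crossings_le_add_of_max (hf : ContinuousOn f (Icc a b)) (has : a ≤ s) (hsb : s ≤ b)
    (hc : 0 < c) (hmax : ∀ u ∈ Icc a b, f u ≤ f s) :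
    crossings f z c a b ≤ crossings f z c a s + crossings f z c s b := by
  have h1 := downcrossings_le_add (z := z) hf has hsb hc fun u hu v hv h _ =>
    Or.inl (h.trans (hmax u ⟨hu.1, hu.2.trans hsb⟩))
  have h2 := downcrossings_le_add (z := -z) hf.neg has hsb hc fun u hu v hv _ h =>
    Or.inr (lt_of_le_of_lt (neg_le_neg (hmax v ⟨has.trans hv.1, hv.2⟩)) h)
  unfold crossings _root_.upcrossings
  simp only [Pi.neg_def] at h2
  omega

theorem crossings_le_add_of_min (hf : ContinuousOn f (Icc a b)) (has : a ≤ s) (hsb : s ≤ b)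
    (hc : 0 < c) (hmin : ∀ u ∈ Icc a b, f s ≤ f u) :
    crossings f z c a b ≤ crossings f z c a s + crossings f z c s b := by
  have h1 := downcrossings_le_add (z := z) hf has hsb hc fun u hu v hv _ h =>
    Or.inr ((hmin v ⟨has.trans hv.1, hv.2⟩).trans_lt h)
  have h2 := downcrossings_le_add (z := -z) hf.neg has hsb hc fun u hu v hv h _ =>
    Or.inl (h.trans (neg_le_neg (hmin u ⟨hu.1, hu.2.trans hsb⟩)))
  unfold crossings _root_.upcrossings
  simp only [Pi.neg_def] at h2
  omega

open Classical in
-- Straddling downcrossings can start at s instead. A straddling upcrossing is lost only if f s lies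
-- in the band, which confines z to an interval of length c.
theorem crossings_le_add_of_max_left (hf : ContinuousOn f (Icc a b)) (has : a ≤ s) (hsb : s ≤ b)
    (hc : 0 < c) (hl : ∀ u ∈ Icc a s, f u ≤ f s) :
    crossings f z c a b ≤ crossings f z c a s + crossings f z c s b +
      if z ∈ Icc (f s - c / 2) (f s + c / 2) then 1 else 0 := by
  have h1 := downcrossings_le_add (z := z) hf has hsb hc fun u hu v hv h _ =>
    Or.inl (h.trans (hl u hu))
  split_ifs with hz
  · have h2 := downcrossings_le_add_one (z := -z) hf.neg has hsb hc
    unfold crossings _root_.upcrossings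
    simp only [Pi.neg_def] at h2
    omega
  · have h2 := downcrossings_le_add (z := -z) hf.neg has hsb hc fun u hu v hv _ _ => by
      by_contra! h
      have h1 : -f s < -z + c / 2 := h.1
      have h2 : -z - c / 2 ≤ -f s := h.2
      exact hz ⟨by linarith, by linarith⟩
    unfold crossings _root_.upcrossings
    simp only [Pi.neg_def] at h2
    omega

/-! ### Dependence on the level: support, measurability, integrability. -/

theorem downcrossings_eq_zero_of_forall (hf : ContinuousOn f (Icc a b)) (hab : a ≤ b) (hc : 0 < c)
    (H : ∀ u v, a ≤ u → u ≤ v → v ≤ b → z + c / 2 ≤ f u → f v < z - c / 2 → False) :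
    downcrossings f z c a b = 0 := by
  by_contra hne
  have h1 := (le_downcrossings_iff hf hab hc).1 (Nat.one_le_iff_ne_zero.2 hne)
  cases h1 with
  | succ h1 h2 h3 h4 h5 => exact H _ _ h1 h2 h5.le h3 h4

theorem crossings_eq_zero_of_notMem (hf : ContinuousOn f (Icc a b)) (hab : a ≤ b) (hc : 0 < c)
    {p q : ℝ} (hpq : ∀ u ∈ Icc a b, f u ∈ Icc p q) (hz : z ∉ Icc (p + c / 2) (q - c / 2)) :
    crossings f z c a b = 0 := by
  have h1 : downcrossings f z c a b = 0 :=
    downcrossings_eq_zero_of_forall hf hab hc fun u v h1 h2 h3 h4 h5 =>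
      hz ⟨by linarith [(hpq v ⟨h1.trans h2, h3⟩).1], by linarith [(hpq u ⟨h1, h2.trans h3⟩).2]⟩
  have h2 : downcrossings (fun u => -f u) (-z) c a b = 0 :=
    downcrossings_eq_zero_of_forall hf.neg hab hc fun u v h1 h2 h3 h4 h5 =>
      hz ⟨by linarith [(hpq u ⟨h1, h2.trans h3⟩).1], by linarith [(hpq v ⟨h1.trans h2, h3⟩).2]⟩
  rw [crossings, _root_.upcrossings, h1, h2]

/-- Lowering the level relaxes the upper condition, and the lower one is strict, so finitely many of
them survive a small shift. -/
theorem DownChain.exists_forall_lower {n : ℕ} (h : DownChain f (z - c / 2) (z + c / 2) b a n) :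
    ∃ ε > 0, ∀ y, z - ε < y → y ≤ z → DownChain f (y - c / 2) (y + c / 2) b a n := by
  induction h with
  | zero h => exact ⟨1, one_pos, fun y _ _ => .zero h⟩
  | @succ a u v n h1 h2 h3 h4 h5 ih =>
    obtain ⟨ε, hε, H⟩ := ih
    refine ⟨min ε (z - c / 2 - f v), lt_min hε (by linarith), fun y hy hyz => ?_⟩
    have h6 := min_le_left ε (z - c / 2 - f v)
    have h7 := min_le_right ε (z - c / 2 - f v)
    exact .succ h1 h2 (by linarith) (by linarith) (H y (by linarith) hyz)

theorem measurable_downcrossings (hf : ContinuousOn f (Icc a b)) (hab : a ≤ b) (hc : 0 < c) :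
    Measurable fun z => downcrossings f z c a b := by
  -- Reflecting the level turns persistence to the left into persistence to the right, the form
  -- needed for measurability of superlevel sets.
  have h : Measurable fun y => downcrossings f (-y) c a b := by
    refine measurable_of_Ici fun n => MeasurableSet.of_mem_nhdsGT fun y hy => ?_
    obtain ⟨ε, hε, H⟩ := ((le_downcrossings_iff hf hab hc).1 hy).exists_forall_lower
    filter_upwards [Ioo_mem_nhdsGT (show y < y + ε by linarith)] with w hw
    exact (le_downcrossings_iff hf hab hc).2 (H _ (by linarith [hw.2]) (by linarith [hw.1]))
  simpa [Function.comp_def] using h.comp measurable_neg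

theorem measurable_crossings (hf : ContinuousOn f (Icc a b)) (hab : a ≤ b) (hc : 0 < c) :
    Measurable fun z => crossings f z c a b :=
  ((measurable_downcrossings hf.neg hab hc).comp measurable_neg).add
    (measurable_downcrossings hf hab hc)

theorem exists_crossings_bound (hf : ContinuousOn f (Icc a b)) (hab : a ≤ b) (hc : 0 < c) :
    ∃ K : ℕ, ∀ z, crossings f z c a b ≤ K := by
  obtain ⟨K, hK⟩ := exists_downChain_bound (f := f) (a := a) (b := b) hf hc
  obtain ⟨K', hK'⟩ := exists_downChain_bound (a := a) (b := b) hf.neg hc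
  exact ⟨K' + K, fun z => add_le_add (hK' _ _ ((le_downcrossings_iff hf.neg hab hc).1 le_rfl))
    (hK _ _ ((le_downcrossings_iff hf hab hc).1 le_rfl))⟩

theorem integrable_crossings_mul (hf : ContinuousOn f (Icc a b)) (hab : a ≤ b) (hc : 0 < c)
    {g : ℝ → ℝ} (hg : Continuous g) :
    Integrable (fun z => (crossings f z c a b : ℝ) * g z) volume := by
  obtain ⟨K, hK⟩ := exists_crossings_bound hf hab hc
  obtain ⟨p, hp⟩ := (isCompact_Icc.image_of_continuousOn hf).bddBelow
  obtain ⟨q, hq⟩ := (isCompact_Icc.image_of_continuousOn hf).bddAbove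
  have hsupp : Function.support (fun z => (crossings f z c a b : ℝ) * g z) ⊆ Icc p q := by
    intro z hz
    by_contra hz'
    apply hz
    have := crossings_eq_zero_of_notMem (z := z) hf hab hc (p := p) (q := q)
      (fun u hu => ⟨hp (mem_image_of_mem f hu), hq (mem_image_of_mem f hu)⟩)
      fun h => hz' ⟨by linarith [h.1], by linarith [h.2]⟩
    simp [this]
  rw [← integrableOn_iff_integrable_of_support_subset hsupp]
  have hgi : IntegrableOn g (Icc p q) := hg.continuousOn.integrableOn_Icc
  refine hgi.bdd_mul (c := K) (measurable_from_nat.comp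
    (measurable_crossings hf hab hc)).aestronglyMeasurable (ae_of_all _ fun z => ?_)
  rw [Real.norm_natCast]
  exact_mod_cast hK z

theorem integrable_crossings (hf : ContinuousOn f (Icc a b)) (hab : a ≤ b) (hc : 0 < c) :
    Integrable (fun z => (crossings f z c a b : ℝ)) volume := by
  simpa using integrable_crossings_mul hf hab hc (continuous_const (y := (1 : ℝ)))

end Crossings

/-! ### The normalizing constants -/

theorem peanoScale_zpow_mul {p : ℝ} (hp : 0 < p) (k : ℤ) :
    peanoScale ((3 : ℝ) ^ k * p) = (3 : ℝ) ^ (-k) * peanoScale p := by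
  unfold peanoScale
  rw [Real.logb_mul (by positivity) hp.ne', ← Real.rpow_intCast 3 k,
    Real.logb_rpow (by norm_num) (by norm_num), ← zpow_add₀ (by norm_num),
    show -((k : ℝ) + Real.logb 3 p) = -Real.logb 3 p + ((-k : ℤ) : ℝ) by push_cast; ring,
    Int.floor_add_intCast, add_comm]

theorem peanoScale_mul_zpow_mul {p : ℝ} (hp : 0 < p) (k : ℤ) :
    peanoScale ((3 : ℝ) ^ k * p) * ((3 : ℝ) ^ k * p) = peanoScale p * p := by
  rw [peanoScale_zpow_mul hp, zpow_neg]
  field_simp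

theorem peanoC_zpow_mul {p : ℝ} (hp : 0 < p) (k : ℤ) :
    peanoC ((3 : ℝ) ^ k * p) = peanoC p := by
  rw [peanoC, peanoScale_mul_zpow_mul hp, peanoC]

theorem peanoScale_mul_mem {p : ℝ} (hp : 0 < p) : peanoScale p * p ∈ Ioc (1 / 3 : ℝ) 1 := by
  have hlog : (3 : ℝ) ^ Real.logb 3 p = p := Real.rpow_logb (by norm_num) (by norm_num) hp
  have h : peanoScale p * p = (3 : ℝ) ^ ((⌊-Real.logb 3 p⌋ : ℝ) + Real.logb 3 p) := by
    rw [Real.rpow_add (by norm_num), hlog, Real.rpow_intCast, peanoScale]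
  have h1 := Int.floor_le (-Real.logb 3 p)
  have h2 := Int.lt_floor_add_one (-Real.logb 3 p)
  rw [h]
  constructor
  · rw [show (1 / 3 : ℝ) = 3 ^ (-1 : ℝ) by rw [Real.rpow_neg_one]; norm_num]
    exact Real.rpow_lt_rpow_of_exponent_lt (by norm_num) (by linarith)
  · exact Real.rpow_le_one_of_one_le_of_nonpos (by norm_num) (by linarith)

theorem peanoScale_eq_zpow {p : ℝ} {n : ℤ} (hl : (3 : ℝ) ^ (-(n + 1)) < p)
    (hr : p ≤ (3 : ℝ) ^ (-n)) : peanoScale p = (3 : ℝ) ^ n := by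
  have hp : 0 < p := lt_trans (by positivity) hl
  unfold peanoScale
  congr 1
  rw [Int.floor_eq_iff]
  have h1 : Real.logb 3 p ≤ -n := by
    rw [Real.logb_le_iff_le_rpow (by norm_num) hp]
    rw [← Int.cast_neg, Real.rpow_intCast]
    exact hr
  have h2 : -(n + 1 : ℝ) < Real.logb 3 p := by
    rw [Real.lt_logb_iff_rpow_lt (by norm_num) hp]
    have : (-(n + 1 : ℝ)) = ((-(n + 1) : ℤ) : ℝ) := by push_cast; ring
    rw [this, Real.rpow_intCast]
    exact hl
  constructor <;> linarith

/-- With y = 3^{⌊-log₃ p⌋} p in (1/3, 1], the concave function y(1 - 3y/4) equals 1/4 at both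
endpoints. The lower bound is what later allows division by C. -/
theorem peanoC_mem {p : ℝ} (hp : 0 < p) : peanoC p ∈ Icc (1 / 4 : ℝ) 1 := by
  obtain ⟨h1, h2⟩ := peanoScale_mul_mem hp
  unfold peanoC
  constructor <;> nlinarith

theorem peanoC_of_mem_Ioc {p : ℝ} (hp : p ∈ Ioc (1 / 3 : ℝ) 1) : peanoC p = p * (1 - 3 / 4 * p) := by
  have : peanoScale p = 1 := by
    have := peanoScale_eq_zpow (p := p) (n := 0) (by norm_num; linarith [hp.1]) (by simpa using hp.2)
    simpa using this
  rw [peanoC, this, one_mul]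

/-- Repeated tripling brings any c in (0,1] into (1/3,1], the range where the crossing problem is
solved directly. -/
theorem triadic_induction {P : ℝ → Prop} (h0 : ∀ c ∈ Ioc (1 / 3 : ℝ) 1, P c)
    (h1 : ∀ c : ℝ, 0 < c → 3 * c ≤ 1 → P (3 * c) → P c) {c : ℝ} (hc0 : 0 < c) (hc1 : c ≤ 1) :
    P c := by
  obtain ⟨n, hn⟩ := exists_pow_lt_of_lt_one hc0 (show (1 / 3 : ℝ) < 1 by norm_num)
  induction n generalizing c with
  | zero => simp at hn; linarith
  | succ n ih =>
    rw [pow_succ] at hn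
    rcases le_or_gt (3 * c) 1 with h | h
    · exact h1 c hc0 h (ih (by linarith) h (by linarith))
    · exact h0 c ⟨by linarith, hc1⟩

/-! ### Upper bound for the mean number of crossings -/

theorem three_zpow_one_mul (c : ℝ) : (3 : ℝ) ^ (1 : ℤ) * c = 3 * c := by simp

theorem continuousOn_peanoX_cell {m i : ℕ} (hi : i < 9 ^ m) :
    ContinuousOn peanoX (Icc ((i : ℝ) / 9 ^ m) ((i + 1) / 9 ^ m)) :=
  continuousOn_peanoX.mono (peanoCell_subset hi)

/-- The affine copy of x on a cell transports chains. The total of both directions is used because a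
reflected cell exchanges them. -/
theorem exists_crossings_cell_le {m i : ℕ} (hi : i < 9 ^ m) :
    ∃ A ε : ℝ, (ε = 1 ∨ ε = -1) ∧ ∀ z c : ℝ, 0 < c →
      crossings peanoX z c (i / 9 ^ m) ((i + 1) / 9 ^ m) ≤
        crossings peanoX ((z - A) * (ε * 3 ^ m)) (3 ^ m * c) 0 1 := by
  obtain ⟨A, ε, hε, h⟩ := exists_peanoX_cell m i hi
  refine ⟨A, ε, hε, fun z c hc => ?_⟩
  have h9 : (0 : ℝ) < 9 ^ m := by positivity
  have h3 : (0 : ℝ) < 3 ^ m := by positivity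
  have hc' : 0 < 3 ^ m * c := by positivity
  have hle : (i : ℝ) / 9 ^ m ≤ (i + 1) / 9 ^ m := by gcongr; linarith
  have hx : ∀ u ∈ Icc ((i : ℝ) / 9 ^ m) ((i + 1) / 9 ^ m),
      3 ^ m * (peanoX u - A) = ε * peanoX (9 ^ m * u - i) := by
    intro u hu
    have := h _ (mem_peanoCell_iff.1 hu)
    rw [show (i + (9 ^ m * u - i)) / 9 ^ m = u by field_simp; ring] at this
    rw [this, one_div, inv_pow]
    field_simp
    ring
  have hφ : ∀ u v : ℝ, (i : ℝ) / 9 ^ m ≤ u → u ≤ v → v ≤ (i + 1) / 9 ^ m →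
      9 ^ m * u - i ≤ 9 ^ m * v - i := fun u v _ huv _ => by gcongr
  have hφa : (0 : ℝ) ≤ 9 ^ m * (i / 9 ^ m) - i := by
    rw [mul_div_cancel₀ _ h9.ne']; linarith
  have hφb : 9 ^ m * (((i : ℝ) + 1) / 9 ^ m) - i ≤ 1 := by
    rw [mul_div_cancel₀ _ h9.ne']; linarith
  have hcell := continuousOn_peanoX_cell hi
  have hmul : ∀ p q : ℝ, p ≤ q → 3 ^ m * p ≤ 3 ^ m * q := fun p q hpq => by gcongr
  have hmul' : ∀ p q : ℝ, p < q → 3 ^ m * p < 3 ^ m * q := fun p q hpq => by gcongr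
  unfold crossings _root_.upcrossings
  rcases hε with rfl | rfl
  · refine add_le_add ?_ ?_
    · refine downcrossings_le_of_map hcell.neg hle hc continuousOn_peanoX.neg zero_le_one hc' hφ hφa
        hφb (fun u hu hh => ?_) fun u hu hh => ?_
      · have := hmul _ _ hh; have := hx u hu; linarith
      · have := hmul' _ _ hh; have := hx u hu; linarith
    · refine downcrossings_le_of_map hcell hle hc continuousOn_peanoX zero_le_one hc' hφ hφa
        hφb (fun u hu hh => ?_) fun u hu hh => ?_
      · have := hmul _ _ hh; have := hx u hu; linarith
      · have := hmul' _ _ hh; have := hx u hu; linarith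
  · rw [add_comm]
    refine add_le_add ?_ ?_
    · refine downcrossings_le_of_map hcell hle hc continuousOn_peanoX.neg zero_le_one hc' hφ hφa
        hφb (fun u hu hh => ?_) fun u hu hh => ?_
      · have := hmul _ _ hh; have := hx u hu; linarith
      · have := hmul' _ _ hh; have := hx u hu; linarith
    · refine downcrossings_le_of_map hcell.neg hle hc continuousOn_peanoX zero_le_one hc' hφ hφa
        hφb (fun u hu hh => ?_) fun u hu hh => ?_
      · have := hmul _ _ hh; have := hx u hu; linarith
      · have := hmul' _ _ hh; have := hx u hu; linarith

theorem integral_crossings_cell_le {m i : ℕ} (hi : i < 9 ^ m) {c : ℝ} (hc : 0 < c) :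
    ∫ z, (crossings peanoX z c (i / 9 ^ m) ((i + 1) / 9 ^ m) : ℝ) ≤
      (1 / 3) ^ m * ∫ z, (crossings peanoX z (3 ^ m * c) 0 1 : ℝ) := by
  obtain ⟨A, ε, hε, h⟩ := exists_crossings_cell_le hi
  have hle : (i : ℝ) / 9 ^ m ≤ (i + 1) / 9 ^ m := by gcongr; linarith
  have hNint := integrable_crossings (continuousOn_peanoX_cell hi) hle hc
  have hε0 : ε * 3 ^ m ≠ 0 := by
    rcases hε with rfl | rfl <;> simp
  have habs : |(ε * 3 ^ m)⁻¹| = (1 / 3 : ℝ) ^ m := by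
    rw [abs_inv, abs_mul, abs_of_pos (by positivity : (0 : ℝ) < 3 ^ m), one_div, inv_pow]
    rcases hε with rfl | rfl <;> simp
  have hNint₁ : Integrable (fun z => (crossings peanoX z (3 ^ m * c) 0 1 : ℝ)) :=
    integrable_crossings continuousOn_peanoX zero_le_one (by positivity)
  have hNint₂ : Integrable fun z => (crossings peanoX (z * (ε * 3 ^ m)) (3 ^ m * c) 0 1 : ℝ) :=
    hNint₁.comp_mul_right' hε0
  calc ∫ z, (crossings peanoX z c (i / 9 ^ m) ((i + 1) / 9 ^ m) : ℝ)
      ≤ ∫ z, (crossings peanoX ((z - A) * (ε * 3 ^ m)) (3 ^ m * c) 0 1 : ℝ) :=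
        integral_mono hNint (hNint₂.comp_sub_right A) fun z => by exact Nat.cast_le.2 (h z c hc)
    _ = ∫ z, (crossings peanoX (z * (ε * 3 ^ m)) (3 ^ m * c) 0 1 : ℝ) :=
        integral_sub_right_eq_self
          (fun z => (crossings peanoX (z * (ε * 3 ^ m)) (3 ^ m * c) 0 1 : ℝ)) A
    _ = (1 / 3) ^ m * ∫ z, (crossings peanoX z (3 ^ m * c) 0 1 : ℝ) := by
        rw [Measure.integral_comp_mul_right
          (fun z => (crossings peanoX z (3 ^ m * c) 0 1 : ℝ)), habs, smul_eq_mul]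

theorem crossings_peanoX_of_third_lt {c : ℝ} (hc : c ∈ Ioc (1 / 3 : ℝ) 1) (z : ℝ) :
    (crossings peanoX z c 0 1 : ℝ) ≤ (Icc (c / 2) (1 - c / 2)).indicator (fun _ => (1 : ℝ)) z := by
  have hc0 : 0 < c := by linarith [hc.1]
  by_cases hz : z ∈ Icc (c / 2) (1 - c / 2)
  · rw [indicator_of_mem hz]
    have hd : downcrossings peanoX z c 0 1 = 0 :=
      downcrossings_eq_zero_of_forall continuousOn_peanoX zero_le_one hc0
        fun u v h1 h2 h3 h4 h5 => by linarith [peanoX_sub_le_third h1 h2 h3, hc.1]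
    have hu : downcrossings (fun u => -peanoX u) (-z) c 0 1 ≤ 1 := by
      by_contra! h
      have := (le_downcrossings_iff continuousOn_peanoX.neg zero_le_one hc0).1 h
      -- Two upcrossings would force a drop larger than c > 1/3 between the end of the first and the
      -- start of the second.
      obtain _ | @⟨_, u, v, _, h1, h2, h3, h4, h5⟩ := this
      obtain _ | @⟨_, u', v', _, h1', h2', h3', h4', h5'⟩ := h5
      have h6 := peanoX_sub_le_third (h1.trans h2) h1' (h2'.trans h5'.le)
      have h7 : -peanoX v < -z - c / 2 := h4
      have h8 : -z + c / 2 ≤ -peanoX u' := h3'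
      linarith [hc.1]
    unfold crossings _root_.upcrossings
    rw [hd]
    exact_mod_cast hu
  · rw [indicator_of_notMem hz, crossings_eq_zero_of_notMem continuousOn_peanoX zero_le_one hc0
      (p := 0) (q := 1) (fun u _ => peanoX_mem_Icc u) (by simpa using hz)]
    simp

theorem integral_crossings_peanoX_of_third_lt {c : ℝ} (hc : c ∈ Ioc (1 / 3 : ℝ) 1) :
    ∫ z, (crossings peanoX z c 0 1 : ℝ) ≤ 1 - c := by
  have hc0 : 0 < c := by linarith [hc.1]
  calc ∫ z, (crossings peanoX z c 0 1 : ℝ)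
      ≤ ∫ z, (Icc (c / 2) (1 - c / 2)).indicator (fun _ => (1 : ℝ)) z :=
        integral_mono (integrable_crossings continuousOn_peanoX zero_le_one hc0)
          ((integrable_indicator_iff measurableSet_Icc).2 (by simp))
          (crossings_peanoX_of_third_lt hc)
    _ = 1 - c := by
        rw [integral_indicator measurableSet_Icc]
        simp [Measure.real]
        rw [ENNReal.toReal_ofReal (by linarith [hc.2])]
        ring

/-- Within a column x reaches its maximum after the first cell and its minimum over the rest after
the second, so both cuts are free; three cells each contribute one third. -/
theorem integral_crossings_column_le {a : ℕ} (ha : a < 3) {c : ℝ} (hc : 0 < c) :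
    ∫ z, (crossings peanoX z c (a / 3) ((a + 1) / 3) : ℝ) ≤
      ∫ z, (crossings peanoX z (3 * c) 0 1 : ℝ) := by
  have ha' : (a : ℝ) ≤ 2 := by exact_mod_cast Nat.le_of_lt_succ ha
  have ha0 : (0 : ℝ) ≤ a := a.cast_nonneg
  have hx1 : peanoX ((3 * a + 1) / 9) = (a + 1) / 3 := by
    have := peanoX_subcell ha (b := 0) (by norm_num) (s := 1) (by norm_num)
    simpa [peanoX_one] using this
  have hx2 : peanoX ((3 * a + 2) / 9) = a / 3 := by
    have := peanoX_subcell ha (b := 1) (by norm_num) (s := 1) (by norm_num)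
    rw [show (3 * a + 2 : ℝ) / 9 = (3 * a + (1 : ℕ) + 1) / 9 by push_cast; ring, this]
    simp [peanoX_one]
  have hcont : ∀ p q : ℝ, 0 ≤ p → q ≤ 1 → ContinuousOn peanoX (Icc p q) :=
    fun p q hp hq => continuousOn_peanoX.mono (Icc_subset_Icc hp hq)
  have key : ∀ z, crossings peanoX z c (a / 3) ((a + 1) / 3) ≤
      crossings peanoX z c (a / 3) ((3 * a + 1) / 9) +
      (crossings peanoX z c ((3 * a + 1) / 9) ((3 * a + 2) / 9) +
      crossings peanoX z c ((3 * a + 2) / 9) ((a + 1) / 3)) := by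
    intro z
    have h1 := crossings_le_add_of_max (z := z) (s := (3 * a + 1) / 9) (hcont (a / 3) ((a + 1) / 3)
      (by positivity) (by linarith)) (by linarith) (by linarith) hc
      fun u hu => by rw [hx1]; exact (peanoX_mem_column ha hu).2
    have h2 := crossings_le_add_of_min (z := z) (s := (3 * a + 2) / 9)
      (hcont ((3 * a + 1) / 9) ((a + 1) / 3)
      (by positivity) (by linarith)) (by linarith) (by linarith) hc
      fun u hu => by
        rw [hx2]; exact (peanoX_mem_column ha ⟨by linarith [hu.1], hu.2⟩).1
    omega
  have hNint : ∀ p q : ℝ, 0 ≤ p → p ≤ q → q ≤ 1 →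
      Integrable fun z => (crossings peanoX z c p q : ℝ) :=
    fun p q hp hpq hq => integrable_crossings (hcont p q hp hq) hpq hc
  have hcell : ∀ b < 3, ∫ z, (crossings peanoX z c ((3 * a + b : ℕ) / 9 ^ 1)
      (((3 * a + b : ℕ) + 1) / 9 ^ 1) : ℝ) ≤
      (1 / 3) ^ 1 * ∫ z, (crossings peanoX z (3 ^ 1 * c) 0 1 : ℝ) :=
    fun b hb => integral_crossings_cell_le (by omega) hc
  have h0 := hcell 0 (by norm_num)
  have h1 := hcell 1 (by norm_num)
  have h2 := hcell 2 (by norm_num)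
  rw [pow_one, pow_one, pow_one] at h0 h1 h2
  rw [show ((3 * a + 0 : ℕ) : ℝ) / 9 = a / 3 by push_cast; ring,
    show (((3 * a + 0 : ℕ) : ℝ) + 1) / 9 = (3 * a + 1) / 9 by push_cast; ring] at h0
  rw [show ((3 * a + 1 : ℕ) : ℝ) / 9 = (3 * a + 1) / 9 by push_cast; ring,
    show (((3 * a + 1 : ℕ) : ℝ) + 1) / 9 = (3 * a + 2) / 9 by push_cast; ring] at h1
  rw [show ((3 * a + 2 : ℕ) : ℝ) / 9 = (3 * a + 2) / 9 by push_cast; ring,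
    show (((3 * a + 2 : ℕ) : ℝ) + 1) / 9 = (a + 1) / 3 by push_cast; ring] at h2
  have i0 := hNint (a / 3) ((3 * a + 1) / 9) (by positivity) (by linarith) (by linarith)
  have i1 := hNint ((3 * a + 1) / 9) ((3 * a + 2) / 9) (by positivity) (by linarith) (by linarith)
  have i2 := hNint ((3 * a + 2) / 9) ((a + 1) / 3) (by positivity) (by linarith) (by linarith)
  have i := hNint (a / 3) ((a + 1) / 3) (by positivity) (by linarith) (by linarith)
  have := integral_mono i (i0.add (i1.add i2)) fun z => by
    simp only [Pi.add_apply]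
    exact_mod_cast key z
  rw [integral_add' i0 (i1.add i2), integral_add' i1 i2] at this
  linarith

/-- At 1/3 and 2/3 everything earlier within the column lies below, so each cut costs at most the
indicator of an interval of length c. -/
theorem integral_crossings_peanoX_le_three_mul {c : ℝ} (hc : 0 < c) :
    ∫ z, (crossings peanoX z c 0 1 : ℝ) ≤
      3 * (∫ z, (crossings peanoX z (3 * c) 0 1 : ℝ)) + 2 * c := by
  have hcont : ∀ p q : ℝ, 0 ≤ p → q ≤ 1 → ContinuousOn peanoX (Icc p q) :=
    fun p q hp hq => continuousOn_peanoX.mono (Icc_subset_Icc hp hq)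
  have hx1 : peanoX (1 / 3) = 1 / 3 := by
    have := peanoX_subcell (a := 1) (b := 0) (by norm_num) (by norm_num) (s := 0) (by norm_num)
    norm_num [peanoX_zero] at this
    simpa using this
  have hx2 : peanoX (2 / 3) = 2 / 3 := by
    have := peanoX_subcell (a := 2) (b := 0) (by norm_num) (by norm_num) (s := 0) (by norm_num)
    norm_num [peanoX_zero] at this
    simpa using this
  have col0 : ∀ u ∈ Icc (0 : ℝ) (1 / 3), peanoX u ≤ 1 / 3 := fun u hu => by
    have := (peanoX_mem_column (a := 0) (by norm_num) (t := u)
      ⟨by simpa using hu.1, by simpa using hu.2⟩).2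
    simpa using this
  have col1 : ∀ u ∈ Icc (1 / 3 : ℝ) (2 / 3), peanoX u ≤ 2 / 3 := fun u hu => by
    have := (peanoX_mem_column (a := 1) (by norm_num) (t := u)
      ⟨by simpa using hu.1, by norm_num; exact hu.2⟩).2
    norm_num at this
    exact this
  set I : ℝ → ℝ → ℝ := fun y z => (Icc (y - c / 2) (y + c / 2)).indicator (fun _ => (1 : ℝ)) z
    with hI
  have hIint : ∀ y, Integrable (I y) := fun y =>
    (integrable_indicator_iff measurableSet_Icc).2 (by simp)
  have hIval : ∀ y, ∫ z, I y z = c := fun y => by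
    rw [integral_indicator measurableSet_Icc]
    simp [Measure.real]
    linarith
  have key : ∀ z, (crossings peanoX z c 0 1 : ℝ) ≤
      (crossings peanoX z c 0 (1 / 3) + (crossings peanoX z c (1 / 3) (2 / 3) +
        crossings peanoX z c (2 / 3) 1)) + (I (1 / 3) z + I (2 / 3) z) := by
    intro z
    have h1 := crossings_le_add_of_max_left (z := z) (s := 1 / 3) continuousOn_peanoX
      (by norm_num) (by norm_num) hc (by rw [hx1]; exact col0)
    have h2 := crossings_le_add_of_max_left (z := z) (s := 2 / 3)
      (hcont (1 / 3) 1 (by norm_num) le_rfl)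
      (by norm_num) (by norm_num) hc (by rw [hx2]; exact col1)
    rw [hx1] at h1
    rw [hx2] at h2
    have h1' : (crossings peanoX z c 0 1 : ℝ) ≤ crossings peanoX z c 0 (1 / 3) +
        crossings peanoX z c (1 / 3) 1 + I (1 / 3) z := by
      simp only [hI, indicator]
      exact_mod_cast h1
    have h2' : (crossings peanoX z c (1 / 3) 1 : ℝ) ≤ crossings peanoX z c (1 / 3) (2 / 3) +
        crossings peanoX z c (2 / 3) 1 + I (2 / 3) z := by
      simp only [hI, indicator]
      exact_mod_cast h2
    linarith
  have hNint : ∀ p q : ℝ, 0 ≤ p → p ≤ q → q ≤ 1 →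
      Integrable fun z => (crossings peanoX z c p q : ℝ) :=
    fun p q hp hpq hq => integrable_crossings (hcont p q hp hq) hpq hc
  have i0 := hNint 0 (1 / 3) (by norm_num) (by norm_num) (by norm_num)
  have i1 := hNint (1 / 3) (2 / 3) (by norm_num) (by norm_num) (by norm_num)
  have i2 := hNint (2 / 3) 1 (by norm_num) (by norm_num) (by norm_num)
  have i := hNint 0 1 (by norm_num) (by norm_num) (by norm_num)
  have := integral_mono i ((i0.add (i1.add i2)).add ((hIint (1 / 3)).add (hIint (2 / 3)))) key
  rw [integral_add' (i0.add (i1.add i2)) ((hIint (1 / 3)).add (hIint (2 / 3))),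
    integral_add' i0 (i1.add i2), integral_add' i1 i2, integral_add' (hIint _) (hIint _),
    hIval, hIval] at this
  have c0 := integral_crossings_column_le (a := 0) (by norm_num) hc
  have c1 := integral_crossings_column_le (a := 1) (by norm_num) hc
  have c2 := integral_crossings_column_le (a := 2) (by norm_num) hc
  norm_num at c0 c1 c2 this
  linarith

theorem integral_crossings_peanoX_le {c : ℝ} (hc0 : 0 < c) (hc1 : c ≤ 1) :
    ∫ z, (crossings peanoX z c 0 1 : ℝ) ≤ peanoC c / c - c / 4 := by
  refine triadic_induction (P := fun c => ∫ z, (crossings peanoX z c 0 1 : ℝ) ≤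
    peanoC c / c - c / 4) (fun c hc => ?_) (fun c hc _ ih => ?_) hc0 hc1
  · refine (integral_crossings_peanoX_of_third_lt hc).trans_eq ?_
    have : c ≠ 0 := by linarith [hc.1]
    rw [peanoC_of_mem_Ioc hc]
    field_simp
    ring
  · have hC := peanoC_zpow_mul hc 1
    rw [three_zpow_one_mul] at hC
    rw [hC] at ih
    refine (integral_crossings_peanoX_le_three_mul hc).trans ?_
    -- The term -c/4 is the one that closes the recursion: 3(-3c/4) + 2c = -c/4.
    have : peanoC c / (3 * c) = (peanoC c / c) / 3 := by field_simp
    linarith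

/-! ### Truncated variation -/

/-- `PartitionSum f c b a w`: there is a partition `a = u₀ ≤ … ≤ uₙ = b`, `n ≥ 1`, with
`∑ (|f uᵢ₊₁ - f uᵢ| - c) = w`. -/
inductive PartitionSum (f : ℝ → ℝ) (c b : ℝ) : ℝ → ℝ → Prop
  | single {a : ℝ} : a ≤ b → PartitionSum f c b a (|f b - f a| - c)
  | cons {a s w : ℝ} : a ≤ s → PartitionSum f c b s w →
      PartitionSum f c b a (|f s - f a| - c + w)

namespace PartitionSum

variable {f : ℝ → ℝ} {a b s c w w' : ℝ}

theorem le (h : PartitionSum f c b a w) : a ≤ b := by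
  induction h with
  | single h => exact h
  | cons h _ ih => exact h.trans ih

theorem append (h : PartitionSum f c s a w) (h' : PartitionSum f c b s w') :
    PartitionSum f c b a (w + w') := by
  induction h with
  | single h => exact .cons h h'
  | cons h _ ih => rw [add_assoc]; exact .cons h ih

/-- At a junction passed upwards, the last step before s and the first step after it merge into one
with the same total increment, so c is subtracted once instead of twice. -/
theorem join (h : PartitionSum f c s a w) (h' : PartitionSum f c b s w')
    (hl : ∀ u ∈ Icc a s, f u ≤ f s) (hr : ∀ u ∈ Icc s b, f s ≤ f u) :
    PartitionSum f c b a (w + w' + c) := by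
  induction h with
  | @single a h =>
    have h1 := hl a ⟨le_rfl, h⟩
    cases h' with
    | single h' =>
      have h2 := hr b ⟨h', le_rfl⟩
      convert! single (h.trans h') using 1
      rw [abs_of_nonneg (by linarith), abs_of_nonneg (by linarith), abs_of_nonneg (by linarith)]
      ring
    | @cons _ t w' h' h'' =>
      have h2 := hr t ⟨h', h''.le⟩
      convert! cons (h.trans h') h'' using 1
      rw [abs_of_nonneg (by linarith), abs_of_nonneg (by linarith), abs_of_nonneg (by linarith)]
      ring
  | cons h _ ih =>
    have := ih fun u hu => hl u ⟨h.trans hu.1, hu.2⟩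
    convert! cons h this using 1
    ring

theorem map {g : ℝ → ℝ} {ψ : ℝ → ℝ} {k : ℝ} (h : PartitionSum f c b a w)
    (hψ : ∀ u v, a ≤ u → u ≤ v → v ≤ b → ψ u ≤ ψ v)
    (hg : ∀ u ∈ Icc a b, ∀ v ∈ Icc a b, |g (ψ u) - g (ψ v)| = k * |f u - f v|) :
    PartitionSum g (k * c) (ψ b) (ψ a) (k * w) := by
  induction h with
  | @single a h =>
    convert! single (f := g) (c := k * c) (hψ _ _ le_rfl h le_rfl) using 1
    rw [hg b ⟨h, le_rfl⟩ a ⟨le_rfl, h⟩]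
    ring
  | @cons a s w h h' ih =>
    have := ih (fun u v hu => hψ u v (h.trans hu))
      fun u hu v hv => hg u ⟨h.trans hu.1, hu.2⟩ v ⟨h.trans hv.1, hv.2⟩
    convert! cons (hψ _ _ le_rfl h h'.le) this using 1
    rw [hg s ⟨h, h'.le⟩ a ⟨le_rfl, h.trans h'.le⟩]
    ring

theorem exists_monotone (h : PartitionSum f c b a w) :
    ∃ (n : ℕ) (u : ℕ → ℝ), (Monotone u ∧ u 0 = a ∧ u n = b) ∧
      w ≤ ∑ i ∈ Finset.range n, max (|f (u (i + 1)) - f (u i)| - c) 0 := by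
  induction h with
  | @single a h =>
    refine ⟨1, fun i => Nat.casesOn i a fun _ => b, ⟨monotone_nat_of_le_succ ?_, rfl, rfl⟩, ?_⟩
    · rintro (_ | i)
      · exact h
      · exact le_rfl
    · simp
  | @cons a s w h _ ih =>
    obtain ⟨n, u, ⟨hu, hu0, hun⟩, hw⟩ := ih
    refine ⟨n + 1, fun i => Nat.casesOn i a u, ⟨monotone_nat_of_le_succ ?_, rfl, hun⟩, ?_⟩
    · rintro (_ | i)
      · exact h.trans_eq hu0.symm
      · exact hu i.le_succ
    · rw [Finset.sum_range_succ']
      have : |f s - f a| - c ≤ max (|f (u 0) - f a| - c) 0 := by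
        rw [hu0]; exact le_max_left _ _
      exact (add_comm _ _).trans_le (add_le_add hw this)

theorem ofReal_le_truncatedVariation (h : PartitionSum f c b a w) :
    ENNReal.ofReal w ≤ truncatedVariation f a b c := by
  obtain ⟨n, u, hu, hw⟩ := h.exists_monotone
  refine (ENNReal.ofReal_le_ofReal hw).trans ?_
  rw [ENNReal.ofReal_sum_of_nonneg fun _ _ => le_max_right _ _]
  exact le_iSup₂_of_le n u (le_iSup_of_le hu le_rfl)

end PartitionSum

/-! ### Truncated variation is at most the integrated crossing number. -/

section Indicatrix

variable {f : ℝ → ℝ} {a b c z : ℝ} {u : ℕ → ℝ} {n : ℕ}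

open Classical in
theorem card_filter_le_downcrossings (hf : ContinuousOn f (Icc a b)) (hc : 0 < c)
    (hu : Monotone u) (hu0 : u 0 = a) (hun : u n = b) :
    ((Finset.range n).filter fun i => z + c / 2 ≤ f (u i) ∧ f (u (i + 1)) < z - c / 2).card ≤
      downcrossings f z c a b := by
  have hab : a ≤ b := by rw [← hu0, ← hun]; exact hu n.zero_le
  rw [le_downcrossings_iff hf hab hc, ← hun]
  clear hun
  induction n with
  | zero => exact .zero hu0.ge
  | succ n ih =>
    rw [Finset.range_add_one, Finset.filter_insert]
    split_ifs with h
    · rw [Finset.card_insert_of_notMem (by simp), Nat.add_comm (Finset.card _)]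
      exact ih.append (m := 1) (.succ le_rfl (hu n.le_succ) h.1 h.2 (.zero le_rfl))
    · exact ih.mono_right (hu n.le_succ)

/-- A step of size more than c crosses the band for every z in its value range shrunk by c/2 at both
ends, an interval of length equal to the truncated increment. Distinct steps give distinct
crossings. -/
theorem sum_indicator_le_crossings (hf : ContinuousOn f (Icc a b)) (hc : 0 < c)
    (hu : Monotone u) (hu0 : u 0 = a) (hun : u n = b) :
    ∑ i ∈ Finset.range n, (Ioo (min (f (u i)) (f (u (i + 1))) + c / 2)
      (max (f (u i)) (f (u (i + 1))) - c / 2)).indicator (fun _ => (1 : ℝ)) z ≤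
      crossings f z c a b := by
  classical
  have h1 := card_filter_le_downcrossings (z := z) hf hc hu hu0 hun
  have h2 := card_filter_le_downcrossings (z := -z) hf.neg hc hu hu0 hun
  rw [Finset.card_filter] at h1 h2
  have h : (((∑ i ∈ Finset.range n, if -z + c / 2 ≤ (-f) (u i) ∧ (-f) (u (i + 1)) < -z - c / 2
      then 1 else 0 : ℕ) + (∑ i ∈ Finset.range n, if z + c / 2 ≤ f (u i) ∧
        f (u (i + 1)) < z - c / 2 then 1 else 0 : ℕ) : ℕ) : ℝ) ≤ crossings f z c a b :=
    Nat.cast_le.2 (add_le_add h2 h1)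
  refine le_trans ?_ h
  rw [← Finset.sum_add_distrib, Nat.cast_sum]
  refine Finset.sum_le_sum fun i _ => ?_
  rw [indicator]
  split_ifs with hz h3 h4 h4 <;> try simp
  · rcases le_total (f (u i)) (f (u (i + 1))) with h | h
    · rw [min_eq_left h, max_eq_right h] at hz
      exact absurd ⟨by simp only [Pi.neg_apply]; linarith [hz.1],
        by simp only [Pi.neg_apply]; linarith [hz.2]⟩ h3
    · rw [min_eq_right h, max_eq_left h] at hz
      exact absurd ⟨by linarith [hz.2], by linarith [hz.1]⟩ h4

theorem truncatedVariation_le_integral_crossings (hf : ContinuousOn f (Icc a b)) (hab : a ≤ b)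
    (hc : 0 < c) :
    truncatedVariation f a b c ≤ ENNReal.ofReal (∫ z, (crossings f z c a b : ℝ)) := by
  refine iSup₂_le fun n u => iSup_le fun ⟨hu, hu0, hun⟩ => ?_
  rw [← ENNReal.ofReal_sum_of_nonneg fun _ _ => le_max_right _ _]
  refine ENNReal.ofReal_le_ofReal ?_
  set S : ℕ → Set ℝ := fun i => Ioo (min (f (u i)) (f (u (i + 1))) + c / 2)
      (max (f (u i)) (f (u (i + 1))) - c / 2)
  have hS : ∀ i, Integrable ((S i).indicator fun _ => (1 : ℝ)) := fun i =>
    (integrable_indicator_iff measurableSet_Ioo).2 (by simp)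
  have hval : ∀ i, ∫ z, (S i).indicator (fun _ => (1 : ℝ)) z =
      max (|f (u (i + 1)) - f (u i)| - c) 0 := fun i => by
    rw [integral_indicator measurableSet_Ioo, setIntegral_const, smul_eq_mul, mul_one,
      Measure.real, Real.volume_Ioo, ENNReal.toReal_ofReal']
    congr 1
    rw [← max_sub_min_eq_abs, max_comm, min_comm]
    ring
  calc ∑ i ∈ Finset.range n, max (|f (u (i + 1)) - f (u i)| - c) 0
      = ∫ z, ∑ i ∈ Finset.range n, (S i).indicator (fun _ => (1 : ℝ)) z := by
        rw [integral_finsetSum _ fun i _ => hS i]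
        exact Finset.sum_congr rfl fun i _ => (hval i).symm
    _ ≤ ∫ z, (crossings f z c a b : ℝ) :=
        integral_mono (integrable_finsetSum _ fun i _ => hS i) (integrable_crossings hf hab hc)
          fun z => sum_indicator_le_crossings hf hc hu hu0 hun

theorem PartitionSum.le_integral_crossings {w : ℝ} (h : PartitionSum f c b a w)
    (hf : ContinuousOn f (Icc a b)) (hc : 0 < c) : w ≤ ∫ z, (crossings f z c a b : ℝ) :=
  (ENNReal.ofReal_le_ofReal_iff (integral_nonneg fun _ => Nat.cast_nonneg _)).1
    (h.ofReal_le_truncatedVariation.trans (truncatedVariation_le_integral_crossings hf h.le hc))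

end Indicatrix

/-! ### Self-similar partitions for the lower bound. -/

theorem partitionSum_cell {m i : ℕ} (hi : i < 9 ^ m) {c w : ℝ}
    (h : PartitionSum peanoX (3 ^ m * c) 1 0 w) :
    PartitionSum peanoX c ((i + 1) / 9 ^ m) (i / 9 ^ m) ((1 / 3) ^ m * w) := by
  obtain ⟨A, ε, hε, hx⟩ := exists_peanoX_cell m i hi
  have := h.map (g := peanoX) (ψ := fun s => (i + s) / 9 ^ m) (k := (1 / 3) ^ m)
    (fun u v _ huv _ => by gcongr) fun u hu v hv => by
      rw [hx u hu, hx v hv, show ∀ p q : ℝ, A + ε * (1 / 3) ^ m * p - (A + ε * (1 / 3) ^ m * q) =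
        ε * ((1 / 3) ^ m * (p - q)) by intros; ring, abs_mul, abs_mul,
        abs_of_pos (by positivity : (0 : ℝ) < (1 / 3) ^ m)]
      rcases hε with rfl | rfl <;> simp
  rw [← mul_assoc, ← mul_pow] at this
  simpa using this

theorem partitionSum_column {a : ℕ} (ha : a < 3) {c w : ℝ}
    (h : PartitionSum peanoX (3 * c) 1 0 w) :
    PartitionSum peanoX c ((a + 1) / 3) (a / 3) w := by
  have hcell : ∀ b < 3, PartitionSum peanoX c (((3 * a + b : ℕ) + 1) / 9 ^ 1)
      ((3 * a + b : ℕ) / 9 ^ 1) ((1 / 3) ^ 1 * w) :=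
    fun b hb => partitionSum_cell (by omega) (by simpa using h)
  have h0 := hcell 0 (by norm_num)
  have h1 := hcell 1 (by norm_num)
  have h2 := hcell 2 (by norm_num)
  rw [show (((3 * a + 0 : ℕ) : ℝ) + 1) / 9 ^ 1 = ((3 * a + 1 : ℕ) : ℝ) / 9 ^ 1 by
    push_cast; ring] at h0
  rw [show (((3 * a + 1 : ℕ) : ℝ) + 1) / 9 ^ 1 = ((3 * a + 2 : ℕ) : ℝ) / 9 ^ 1 by
    push_cast; ring] at h1
  convert! (h0.append h1).append h2 using 1
  · push_cast; ring
  · push_cast; ring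
  · ring

theorem partitionSum_peanoX {c : ℝ} (hc0 : 0 < c) (hc1 : c ≤ 1) :
    PartitionSum peanoX c 1 0 (peanoC c / c - c / 4) := by
  refine triadic_induction (P := fun c => PartitionSum peanoX c 1 0
    (peanoC c / c - c / 4)) (fun c hc => ?_) (fun c hc _ ih => ?_) hc0 hc1
  · convert! PartitionSum.single (f := peanoX) (c := c) (zero_le_one (α := ℝ)) using 1
    have : c ≠ 0 := by linarith [hc.1]
    rw [peanoC_of_mem_Ioc hc, peanoX_zero, peanoX_one]
    simp
    field_simp
    ring
  · have hC := peanoC_zpow_mul hc 1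
    rw [three_zpow_one_mul] at hC
    rw [hC] at ih
    have h0 := partitionSum_column (a := 0) (by norm_num) ih
    have h1 := partitionSum_column (a := 1) (by norm_num) ih
    have h2 := partitionSum_column (a := 2) (by norm_num) ih
    norm_num at h0 h1 h2
    have c0 : ∀ u ∈ Icc (0 : ℝ) (1 / 3), peanoX u ∈ Icc (0 : ℝ) (1 / 3) := by
      intro u
      have := @peanoX_mem_column 0 (by norm_num) u
      norm_num at this
      simpa using this
    have c1 : ∀ u ∈ Icc (1 / 3 : ℝ) (2 / 3), peanoX u ∈ Icc (1 / 3 : ℝ) (2 / 3) := by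
      intro u
      have := @peanoX_mem_column 1 (by norm_num) u
      norm_num at this
      simpa using this
    have c2 : ∀ u ∈ Icc (2 / 3 : ℝ) 1, peanoX u ∈ Icc (2 / 3 : ℝ) 1 := by
      intro u
      have := @peanoX_mem_column 2 (by norm_num) u
      norm_num at this
      simpa using this
    have x1 : peanoX (1 / 3) = 1 / 3 := le_antisymm
      (c0 _ (by norm_num)).2 (c1 _ (by norm_num)).1
    have x2 : peanoX (2 / 3) = 2 / 3 := le_antisymm
      (c1 _ (by norm_num)).2 (c2 _ (by norm_num)).1
    -- The columns increase through 1/3 and 2/3, so each merge gains c; this is the 2c of the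
    -- recursion.
    have h01 := h0.join h1 (fun u hu => by rw [x1]; exact (c0 u hu).2)
      (fun u hu => by rw [x1]; exact (c1 u hu).1)
    have h012 := h01.join h2 (fun u hu => by
        rw [x2]
        rcases le_total u (1 / 3) with h | h
        · linarith [(c0 u ⟨hu.1, h⟩).2]
        · exact (c1 u ⟨h, hu.2⟩).2)
      (fun u hu => by rw [x2]; exact (c2 u hu).1)
    convert! h012 using 1
    field_simp
    ring

theorem partitionSum_peanoX_cell {m i : ℕ} (hi : i < 9 ^ m) {c : ℝ} (hc0 : 0 < c)
    (hc1 : 3 ^ m * c ≤ 1) :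
    PartitionSum peanoX c ((i + 1) / 9 ^ m) (i / 9 ^ m) (peanoC c / (9 ^ m * c) - c / 4) := by
  have h := partitionSum_cell hi (partitionSum_peanoX (by positivity) hc1)
  have hC : peanoC (3 ^ m * c) = peanoC c := by
    have := peanoC_zpow_mul hc0 m
    rwa [zpow_natCast] at this
  convert! h using 1
  rw [hC, show (9 : ℝ) = 3 * 3 by norm_num, mul_pow, one_div, inv_pow]
  field_simp

/-! ### Weighted crossing numbers of the Peano coordinate -/

theorem continuousOn_peanoX_Icc_zero {t : ℝ} (ht : t ≤ 1) : ContinuousOn peanoX (Icc 0 t) :=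
  continuousOn_peanoX.mono (Icc_subset_Icc_right ht)

theorem peanoC_pow_mul {c : ℝ} (hc : 0 < c) (m : ℕ) : peanoC (3 ^ m * c) = peanoC c := by
  have := peanoC_zpow_mul hc m
  rwa [zpow_natCast] at this

theorem partitionSum_peanoX_initial {m j : ℕ} (hj : j ≤ 9 ^ m) {c : ℝ} (hc0 : 0 < c)
    (hc1 : 3 ^ m * c ≤ 1) :
    PartitionSum peanoX c (j / 9 ^ m) 0 (j * (peanoC c / (9 ^ m * c) - c / 4) - c) := by
  induction j with
  -- The degenerate partition of [0,0] has one step, which accounts for the extra -c.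
  | zero => simpa using PartitionSum.single (f := peanoX) (c := c) (le_refl (0 : ℝ))
  | succ j ih =>
    have := (ih (by omega)).append (partitionSum_peanoX_cell (by omega) hc0 hc1)
    convert! this using 1
    · push_cast; ring
    · push_cast; ring

/-- Complete cells before t are used in full and the remainder is bridged by one step. The
unfinished cell costs at most 9⁻ᵐ after multiplication by c; the truncation terms are of order 9^m
c². -/
theorem exists_partitionSum_peanoX (m : ℕ) {c t : ℝ} (hc0 : 0 < c) (hc1 : 3 ^ m * c ≤ 1)
    (ht : t ∈ Icc (0 : ℝ) 1) :
    ∃ w, PartitionSum peanoX c t 0 w ∧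
      peanoC c * t - 1 / 9 ^ m - (9 ^ m + 2) * c ^ 2 ≤ c * w := by
  obtain ⟨j, hj, htj⟩ := exists_mem_peanoCell m ht
  refine ⟨_, (partitionSum_peanoX_initial hj.le hc0 hc1).append (.single htj.1), ?_⟩
  have h9 : (0 : ℝ) < 9 ^ m := by positivity
  obtain ⟨hC0, hC1⟩ := peanoC_mem hc0
  have h1 : c * (peanoC c / (9 ^ m * c)) = peanoC c * (1 / 9 ^ m) := by field_simp
  have h2 : (j : ℝ) ≤ 9 ^ m := by exact_mod_cast hj.le
  have h3 : peanoC c * t ≤ peanoC c * ((j + 1) * (1 / 9 ^ m)) := by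
    refine mul_le_mul_of_nonneg_left ?_ (by linarith)
    have := htj.2
    rwa [div_eq_mul_one_div] at this
  have h4 : (0 : ℝ) < 1 / 9 ^ m := by positivity
  have h5 : peanoC c * (1 / 9 ^ m) ≤ 1 / 9 ^ m := mul_le_of_le_one_left h4.le hC1
  have h6 := abs_nonneg (peanoX t - peanoX (j / 9 ^ m))
  have h7 : 0 ≤ c * |peanoX t - peanoX (j / 9 ^ m)| := by positivity
  have h8 : (j : ℝ) * c ^ 2 ≤ 9 ^ m * c ^ 2 := by gcongr
  have h9' : 0 ≤ 9 ^ m * c ^ 2 := by positivity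
  have e : c * (j * (peanoC c / (9 ^ m * c) - c / 4) - c + (|peanoX t - peanoX (j / 9 ^ m)| - c)) =
      j * (c * (peanoC c / (9 ^ m * c))) - j * c ^ 2 / 4 - 2 * c ^ 2 +
        c * |peanoX t - peanoX (j / 9 ^ m)| := by ring
  rw [e, h1]
  linarith

theorem mul_integral_crossings_cell_le {m i : ℕ} (hi : i < 9 ^ m) {c : ℝ} (hc0 : 0 < c)
    (hc1 : 3 ^ m * c ≤ 1) :
    c * ∫ z, (crossings peanoX z c (i / 9 ^ m) ((i + 1) / 9 ^ m) : ℝ) ≤ peanoC c / 9 ^ m := by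
  have h1 := integral_crossings_cell_le hi hc0
  have h2 := integral_crossings_peanoX_le (c := 3 ^ m * c) (by positivity) hc1
  rw [peanoC_pow_mul hc0] at h2
  have h3 : ∫ z, (crossings peanoX z (3 ^ m * c) 0 1 : ℝ) ≤ peanoC c / (3 ^ m * c) :=
    h2.trans (sub_le_self _ (by positivity))
  calc c * ∫ z, (crossings peanoX z c (i / 9 ^ m) ((i + 1) / 9 ^ m) : ℝ)
      ≤ c * ((1 / 3) ^ m * (peanoC c / (3 ^ m * c))) := by gcongr; exact h1.trans (by gcongr)
    _ = peanoC c / 9 ^ m := by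
      rw [show (9 : ℝ) = 3 * 3 by norm_num, mul_pow, one_div, inv_pow]
      field_simp

theorem crossings_initial_le {m j : ℕ} (hj : j ≤ 9 ^ m) {c : ℝ} (hc : 0 < c) (z : ℝ) :
    crossings peanoX z c 0 (j / 9 ^ m) ≤
      ∑ i ∈ Finset.range j, crossings peanoX z c (i / 9 ^ m) ((i + 1) / 9 ^ m) + 2 * j := by
  have h9 : (0 : ℝ) < 9 ^ m := by positivity
  induction j with
  | zero =>
    have : crossings peanoX z c 0 ((0 : ℕ) / 9 ^ m) = 0 := by
      rw [Nat.cast_zero, zero_div]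
      refine crossings_eq_zero_of_notMem (p := 0) (q := 0) (continuousOn_peanoX_Icc_zero zero_le_one)
        le_rfl hc (fun u hu => ?_) fun h => ?_
      · rw [Icc_self, mem_singleton_iff] at hu
        simp [hu, peanoX_zero]
      · linarith [h.1, h.2]
    rw [this]
    exact Nat.zero_le _
  | succ j ih =>
    have hj1 : ((j + 1 : ℕ) : ℝ) / 9 ^ m ≤ 1 := by
      rw [div_le_one h9]; exact_mod_cast hj
    have hle : (j : ℝ) / 9 ^ m ≤ (j + 1 : ℕ) / 9 ^ m := by gcongr; omega
    have h := crossings_le_add_two (z := z) (continuousOn_peanoX_Icc_zero hj1)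
      (s := j / 9 ^ m) (by positivity) hle hc
    have := ih (by omega)
    rw [Finset.sum_range_succ]
    push_cast at h ⊢
    omega

/-- For every time s in the cell, g on the relevant levels is at most g(x(s)) + ω; averaging the
resulting bound over s produces the time integral. -/
theorem mul_integral_crossings_cell_mul_le {m i : ℕ} (hi : i < 9 ^ m) {c : ℝ} (hc0 : 0 < c)
    (hc1 : 3 ^ m * c ≤ 1) {g : ℝ → ℝ} (hg : Continuous g) (hg0 : ∀ z ∈ Icc (0 : ℝ) 1, 0 ≤ g z)
    {ω : ℝ} (hω0 : 0 ≤ ω)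
    (hω : ∀ y ∈ Icc (0 : ℝ) 1, ∀ z ∈ Icc (0 : ℝ) 1, |y - z| ≤ (1 / 3) ^ m → |g y - g z| ≤ ω) :
    c * ∫ z, (crossings peanoX z c (i / 9 ^ m) ((i + 1) / 9 ^ m) : ℝ) * g z ≤
      peanoC c * ((∫ s in ((i : ℝ) / 9 ^ m)..((i + 1) / 9 ^ m), g (peanoX s)) + ω / 9 ^ m) := by
  have h9 : (0 : ℝ) < 9 ^ m := by positivity
  have hle : (i : ℝ) / 9 ^ m ≤ (i + 1) / 9 ^ m := by gcongr; linarith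
  have hcont := continuousOn_peanoX_cell hi
  have hpt : ∀ s ∈ Icc ((i : ℝ) / 9 ^ m) ((i + 1) / 9 ^ m),
      c * ∫ z, (crossings peanoX z c (i / 9 ^ m) ((i + 1) / 9 ^ m) : ℝ) * g z ≤
        peanoC c / 9 ^ m * (g (peanoX s) + ω) := by
    intro s hs
    have hgs := hg0 _ (peanoX_mem_Icc s)
    have h1 : ∫ z, (crossings peanoX z c (i / 9 ^ m) ((i + 1) / 9 ^ m) : ℝ) * g z ≤
        ∫ z, (crossings peanoX z c (i / 9 ^ m) ((i + 1) / 9 ^ m) : ℝ) * (g (peanoX s) + ω) := by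
      refine integral_mono (integrable_crossings_mul hcont hle hc0 hg)
        (integrable_crossings_mul hcont hle hc0 continuous_const) fun z => ?_
      by_cases hz : crossings peanoX z c (i / 9 ^ m) ((i + 1) / 9 ^ m) = 0
      · simp [hz]
      · refine mul_le_mul_of_nonneg_left ?_ (Nat.cast_nonneg _)
        have hz1 : z ∈ Icc (0 : ℝ) 1 := by
          by_contra h
          refine hz (crossings_eq_zero_of_notMem hcont hle hc0 (p := 0) (q := 1)
            (fun u _ => peanoX_mem_Icc u) fun h' => h ⟨by linarith [h'.1], by linarith [h'.2]⟩)
        -- A level that x misses on the cell has x on one side of it by connectedness, hence no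
        -- crossings.
        have hz2 : ∃ u ∈ Icc ((i : ℝ) / 9 ^ m) ((i + 1) / 9 ^ m), peanoX u = z := by
          have hconn := (isPreconnected_Icc.image _ hcont).ordConnected
          by_contra hne
          apply hz
          have hside : (∀ u ∈ Icc ((i : ℝ) / 9 ^ m) ((i + 1) / 9 ^ m), peanoX u ∈ Icc z 1) ∨
              ∀ u ∈ Icc ((i : ℝ) / 9 ^ m) ((i + 1) / 9 ^ m), peanoX u ∈ Icc 0 z := by
            by_contra! h
            obtain ⟨⟨u, hu, hu'⟩, v, hv, hv'⟩ := h
            have h1 : peanoX u ≤ z := by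
              by_contra! h; exact hu' ⟨h.le, (peanoX_mem_Icc u).2⟩
            have h2 : z ≤ peanoX v := by
              by_contra! h; exact hv' ⟨(peanoX_mem_Icc v).1, h.le⟩
            exact hne (hconn.out (mem_image_of_mem _ hu) (mem_image_of_mem _ hv) ⟨h1, h2⟩)
          rcases hside with h | h
          · exact crossings_eq_zero_of_notMem hcont hle hc0 h fun h' => by linarith [h'.1]
          · exact crossings_eq_zero_of_notMem hcont hle hc0 h fun h' => by linarith [h'.2]
        obtain ⟨u, hu, rfl⟩ := hz2
        have := hω _ hz1 _ (peanoX_mem_Icc s) (abs_peanoX_sub_le_of_mem_cell hi hu hs)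
        linarith [le_abs_self (g (peanoX u) - g (peanoX s))]
    rw [integral_mul_const] at h1
    calc c * ∫ z, (crossings peanoX z c (i / 9 ^ m) ((i + 1) / 9 ^ m) : ℝ) * g z
        ≤ c * ((∫ z, (crossings peanoX z c (i / 9 ^ m) ((i + 1) / 9 ^ m) : ℝ)) *
            (g (peanoX s) + ω)) := by gcongr
      _ = (c * ∫ z, (crossings peanoX z c (i / 9 ^ m) ((i + 1) / 9 ^ m) : ℝ)) *
            (g (peanoX s) + ω) := by ring
      _ ≤ peanoC c / 9 ^ m * (g (peanoX s) + ω) := by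
          gcongr
          exact mul_integral_crossings_cell_le hi hc0 hc1
  have hgx : ContinuousOn (fun s => g (peanoX s)) (uIcc ((i : ℝ) / 9 ^ m) ((i + 1) / 9 ^ m)) := by
    rw [uIcc_of_le hle]
    exact hg.comp_continuousOn hcont
  have hI : IntervalIntegrable (fun s => g (peanoX s)) volume
    ((i : ℝ) / 9 ^ m) ((i + 1) / 9 ^ m) := hgx.intervalIntegrable
  have h2 := intervalIntegral.integral_mono_on (μ := volume) hle
    (intervalIntegrable_const (μ := volume)
      (c := c * ∫ z, (crossings peanoX z c (i / 9 ^ m) ((i + 1) / 9 ^ m) : ℝ) * g z))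
    ((hI.add intervalIntegrable_const).const_mul (peanoC c / 9 ^ m)) hpt
  rw [intervalIntegral.integral_const, intervalIntegral.integral_const_mul,
    intervalIntegral.integral_add hI intervalIntegrable_const,
    intervalIntegral.integral_const,
    show ((i : ℝ) + 1) / 9 ^ m - i / 9 ^ m = 1 / 9 ^ m by ring, smul_eq_mul, smul_eq_mul] at h2
  have h3 := mul_le_mul_of_nonneg_left h2 h9.le
  rw [← mul_assoc, mul_one_div_cancel h9.ne', one_mul, ← mul_assoc,
    mul_div_cancel₀ _ h9.ne', mul_comm (1 / 9 ^ m) ω, mul_one_div] at h3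
  exact h3

theorem mul_integral_crossings_mul_le {m : ℕ} {c : ℝ} (hc0 : 0 < c) (hc1 : 3 ^ m * c ≤ 1)
    {g : ℝ → ℝ} (hg : Continuous g) {B : ℝ} (hg0 : ∀ z ∈ Icc (0 : ℝ) 1, g z ∈ Icc 0 B)
    {ω : ℝ} (hω0 : 0 ≤ ω)
    (hω : ∀ y ∈ Icc (0 : ℝ) 1, ∀ z ∈ Icc (0 : ℝ) 1, |y - z| ≤ (1 / 3) ^ m → |g y - g z| ≤ ω)
    {t : ℝ} (ht : t ∈ Icc (0 : ℝ) 1) :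
    c * ∫ z, (crossings peanoX z c 0 t : ℝ) * g z ≤
      peanoC c * (∫ s in (0 : ℝ)..t, g (peanoX s)) + ω + B / 9 ^ m + 2 * 9 ^ m * B * c := by
  have h9 : (0 : ℝ) < 9 ^ m := by positivity
  obtain ⟨hC0, hC1⟩ := peanoC_mem hc0
  obtain ⟨j', hj, htj⟩ := exists_mem_peanoCell m ht
  have hB0 : 0 ≤ B := (hg0 0 (by simp)).1.trans (hg0 0 (by simp)).2
  -- The cell containing t is completed to its right end; the overshoot is at most one cell, at cost
  -- B/9^m.
  set J := j' + 1 with hJ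
  have hJm : J ≤ 9 ^ m := hj
  have hJm' : (J : ℝ) ≤ 9 ^ m := by exact_mod_cast hJm
  have hJ1 : (J : ℝ) / 9 ^ m ≤ 1 := by rwa [div_le_one h9]
  have htJ : t ≤ J / 9 ^ m := by rw [hJ]; push_cast; exact htj.2
  have hJt : (J : ℝ) / 9 ^ m ≤ t + 1 / 9 ^ m := by
    have := htj.1; rw [hJ]; push_cast; rw [add_div]; linarith
  have hcell : ∀ i ∈ Finset.range J, Integrable fun z =>
      (crossings peanoX z c (i / 9 ^ m) ((i + 1) / 9 ^ m) : ℝ) * g z := fun i hi =>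
    integrable_crossings_mul (continuousOn_peanoX_cell ((Finset.mem_range.1 hi).trans_le hJm))
      (by gcongr; linarith) hc0 hg
  have hind : Integrable ((Icc (0 : ℝ) 1).indicator fun _ => 2 * (J : ℝ) * B) :=
    (integrable_indicator_iff measurableSet_Icc).2 continuousOn_const.integrableOn_Icc
  have hpt : ∀ z, (crossings peanoX z c 0 t : ℝ) * g z ≤
      ∑ i ∈ Finset.range J,
        (crossings peanoX z c (i / 9 ^ m) ((i + 1) / 9 ^ m) : ℝ) * g z +
        (Icc (0 : ℝ) 1).indicator (fun _ => 2 * (J : ℝ) * B) z := by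
    intro z
    rw [← Finset.sum_mul]
    by_cases hz : z ∈ Icc (0 : ℝ) 1
    · rw [indicator_of_mem hz]
      obtain ⟨hgz, hgB⟩ := hg0 z hz
      have h1 : (crossings peanoX z c 0 t : ℝ) ≤
          ∑ i ∈ Finset.range J, (crossings peanoX z c (i / 9 ^ m) ((i + 1) / 9 ^ m) : ℝ) +
            2 * J := by
        have := (crossings_mono_right (z := z) (continuousOn_peanoX_Icc_zero hJ1) ht.1 htJ
          hc0).trans (crossings_initial_le hJm hc0 z)
        calc (crossings peanoX z c 0 t : ℝ) ≤ _ := Nat.cast_le.2 this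
          _ = _ := by push_cast; rfl
      calc (crossings peanoX z c 0 t : ℝ) * g z
          ≤ (∑ i ∈ Finset.range J, (crossings peanoX z c (i / 9 ^ m) ((i + 1) / 9 ^ m) : ℝ) +
            2 * J) * g z := by gcongr
        _ ≤ _ := by
            rw [add_mul]
            gcongr
    · rw [indicator_of_notMem hz]
      have h0 : ∀ p q : ℝ, 0 ≤ p → p ≤ q → q ≤ 1 → crossings peanoX z c p q = 0 :=
        fun p q hp hpq hq => crossings_eq_zero_of_notMem
          (continuousOn_peanoX.mono (Icc_subset_Icc hp hq)) hpq hc0 (p := 0) (q := 1)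
            (fun u _ => peanoX_mem_Icc u) fun h' => hz ⟨by linarith [h'.1], by linarith [h'.2]⟩
      rw [h0 0 t le_rfl ht.1 ht.2, Finset.sum_eq_zero]
      · simp
      · intro i hi
        have hiJ : i < 9 ^ m := (Finset.mem_range.1 hi).trans_le hJm
        rw [h0 _ _ (by positivity) (by gcongr; linarith) (by
          rw [div_le_one h9]; exact_mod_cast hiJ)]
        simp
  have h1 := integral_mono (integrable_crossings_mul (continuousOn_peanoX_Icc_zero ht.2) ht.1 hc0
    hg) ((integrable_finsetSum _ hcell).add hind) hpt
  rw [integral_add' (integrable_finsetSum _ hcell) hind,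
    integral_finsetSum _ hcell, integral_indicator measurableSet_Icc,
    setIntegral_const] at h1
  have hvol : volume.real (Icc (0 : ℝ) 1) = 1 := by simp [Measure.real]
  rw [hvol, one_smul] at h1
  have hgx : ContinuousOn (fun s => g (peanoX s)) (Icc 0 1) :=
    hg.comp_continuousOn continuousOn_peanoX
  have hII : ∀ p q : ℝ, p ∈ Icc (0 : ℝ) 1 → q ∈ Icc (0 : ℝ) 1 →
      IntervalIntegrable (fun s => g (peanoX s)) volume p q := fun p q hp hq =>
    (hgx.mono (uIcc_subset_Icc hp hq)).intervalIntegrable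
  have hsum : ∑ i ∈ Finset.range J, (∫ s in ((i : ℝ) / 9 ^ m)..((i + 1) / 9 ^ m), g (peanoX s)) =
      ∫ s in (0 : ℝ)..(J / 9 ^ m), g (peanoX s) := by
    have := intervalIntegral.sum_integral_adjacent_intervals (μ := volume)
      (f := fun s => g (peanoX s)) (a := fun i : ℕ => (i : ℝ) / 9 ^ m) (n := J) fun k hk => by
        have hk1 : ((k + 1 : ℕ) : ℝ) ≤ 9 ^ m := by
          exact_mod_cast (Nat.succ_le_of_lt hk).trans hJm
        refine hII _ _ ⟨by positivity, ?_⟩ ⟨by positivity, ?_⟩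
        · rw [div_le_one h9]; push_cast at hk1; linarith
        · rwa [div_le_one h9]
    simpa using this
  have htail : ∫ s in (0 : ℝ)..(J / 9 ^ m), g (peanoX s) ≤
      (∫ s in (0 : ℝ)..t, g (peanoX s)) + B / 9 ^ m := by
    have hJmem : (J : ℝ) / 9 ^ m ∈ Icc (0 : ℝ) 1 := ⟨by positivity, hJ1⟩
    rw [← intervalIntegral.integral_add_adjacent_intervals
      (hII 0 t (by simp) ht) (hII t _ ht hJmem)]
    have := intervalIntegral.integral_mono_on (μ := volume) htJ (hII t _ ht hJmem)
      (intervalIntegrable_const (c := B)) fun s _ => (hg0 _ (peanoX_mem_Icc s)).2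
    rw [intervalIntegral.integral_const, smul_eq_mul] at this
    have h3 : (J / 9 ^ m - t) * B ≤ 1 / 9 ^ m * B := by gcongr; linarith
    have h4 : 1 / 9 ^ m * B = B / 9 ^ m := by ring
    linarith
  have hcells : c * ∑ i ∈ Finset.range J,
      ∫ z, (crossings peanoX z c (i / 9 ^ m) ((i + 1) / 9 ^ m) : ℝ) * g z ≤
      peanoC c * ((∫ s in (0 : ℝ)..(J / 9 ^ m), g (peanoX s)) + J * (ω / 9 ^ m)) := by
    have hconst : (J : ℝ) * (ω / 9 ^ m) = ∑ _i ∈ Finset.range J, ω / 9 ^ m := by simp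
    rw [Finset.mul_sum, ← hsum, hconst, ← Finset.sum_add_distrib, Finset.mul_sum]
    exact Finset.sum_le_sum fun i hi => mul_integral_crossings_cell_mul_le
      ((Finset.mem_range.1 hi).trans_le hJm) hc0 hc1 hg (fun z hz => (hg0 z hz).1) hω0 hω
  have hω1 : J * (ω / 9 ^ m) ≤ ω := by
    rw [mul_div_assoc', div_le_iff₀ h9, mul_comm]
    gcongr
  have hfin : peanoC c * ((∫ s in (0 : ℝ)..(J / 9 ^ m), g (peanoX s)) + J * (ω / 9 ^ m)) ≤
      peanoC c * (∫ s in (0 : ℝ)..t, g (peanoX s)) + ω + B / 9 ^ m := by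
    have h5 : peanoC c * ((∫ s in (0 : ℝ)..(J / 9 ^ m), g (peanoX s)) + J * (ω / 9 ^ m)) ≤
        peanoC c * ((∫ s in (0 : ℝ)..t, g (peanoX s)) + (B / 9 ^ m + ω)) := by
      refine mul_le_mul_of_nonneg_left ?_ (by linarith)
      linarith
    have h6 : peanoC c * (B / 9 ^ m + ω) ≤ B / 9 ^ m + ω :=
      mul_le_of_le_one_left (by positivity) hC1
    linarith
  have h7 : c * (2 * J * B) ≤ 2 * 9 ^ m * B * c := by
    have : c * (2 * J * B) ≤ c * (2 * 9 ^ m * B) := by gcongr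
    linarith
  have h8 := mul_le_mul_of_nonneg_left h1 hc0.le
  rw [mul_add] at h8
  linarith

/-- Both B + g and B - g are nonnegative on [0,1], so the upper bound applies to each. Subtracting
the lower bound for B times the total mass bounds the error for g and for -g. -/
theorem eventually_abs_crossings_sub_lt {g : ℝ → ℝ} (hg : Continuous g) {ε : ℝ} (hε : 0 < ε) :
    ∀ᶠ c : ℝ in 𝓝[>] 0, ∀ t ∈ Icc (0 : ℝ) 1,
      |c * (∫ z, (crossings peanoX z c 0 t : ℝ) * g z) -
        peanoC c * ∫ s in (0 : ℝ)..t, g (peanoX s)| < ε := by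
  obtain ⟨B, hB⟩ := isCompact_Icc.exists_bound_of_continuousOn (s := Icc (0 : ℝ) 1)
    hg.continuousOn
  have hB0 : 0 ≤ B := (norm_nonneg _).trans (hB 0 (by simp))
  obtain ⟨δ, hδ, hu⟩ := Metric.uniformContinuousOn_iff.1
    (isCompact_Icc.uniformContinuousOn_of_continuous (s := Icc (0 : ℝ) 1) hg.continuousOn)
    (ε / 4) (by linarith)
  -- The level m is fixed before c: 3B/9^m collects 2B/9^m from the overshoot and B/9^m from the
  -- mass bound.
  obtain ⟨m, hm1, hm2⟩ : ∃ m : ℕ, (1 / 3 : ℝ) ^ m < δ ∧ 3 * B * (1 / 9) ^ m < ε / 4 := by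
    have h1 : Tendsto (fun m : ℕ => (1 / 3 : ℝ) ^ m) atTop (𝓝 0) :=
      tendsto_pow_atTop_nhds_zero_of_lt_one (by norm_num) (by norm_num)
    have h2 : Tendsto (fun m : ℕ => 3 * B * (1 / 9 : ℝ) ^ m) atTop (𝓝 (3 * B * 0)) :=
      (tendsto_pow_atTop_nhds_zero_of_lt_one (by norm_num) (by norm_num)).const_mul _
    rw [mul_zero] at h2
    exact ((h1.eventually_lt_const hδ).and (h2.eventually_lt_const (by linarith))).exists
  have hlim : ∀ᶠ c : ℝ in 𝓝[>] 0, 4 * 9 ^ m * B * c + B * ((9 ^ m + 2) * c ^ 2) < ε / 4 := by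
    refine nhdsWithin_le_nhds (ContinuousAt.eventually_lt (by fun_prop) continuousAt_const ?_)
    simp; linarith
  have hlim' : ∀ᶠ c : ℝ in 𝓝[>] 0, 3 ^ m * c < 1 :=
    nhdsWithin_le_nhds (ContinuousAt.eventually_lt (by fun_prop) continuousAt_const (by simp))
  filter_upwards [hlim, hlim', self_mem_nhdsWithin] with c hc1 hc2 hc0 t ht
  replace hc0 : 0 < c := hc0
  have habs : ∀ z ∈ Icc (0 : ℝ) 1, |g z| ≤ B := hB
  have hω : ∀ y ∈ Icc (0 : ℝ) 1, ∀ z ∈ Icc (0 : ℝ) 1, |y - z| ≤ (1 / 3) ^ m →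
      |g y - g z| ≤ ε / 4 := fun y hy z hz h => (hu y hy z hz (h.trans_lt hm1)).le
  have hplus := mul_integral_crossings_mul_le (m := m) hc0 hc2.le (g := fun z => B + g z)
    (B := 2 * B) (ω := ε / 4) (by fun_prop)
    (fun z hz => by
      have := abs_le.1 (habs z hz)
      exact ⟨by linarith [this.1], by linarith [this.2]⟩) (by linarith)
    (fun y hy z hz h => by rw [add_sub_add_left_eq_sub]; exact hω y hy z hz h) ht
  have hminus := mul_integral_crossings_mul_le (m := m) hc0 hc2.le (g := fun z => B - g z)
    (B := 2 * B) (ω := ε / 4) (by fun_prop)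
    (fun z hz => by
      have := abs_le.1 (habs z hz)
      exact ⟨by linarith [this.2], by linarith [this.1]⟩) (by linarith)
    (fun y hy z hz h => by
      rw [sub_sub_sub_cancel_left, abs_sub_comm]; exact hω y hy z hz h) ht
  obtain ⟨w, hw, hwle⟩ := exists_partitionSum_peanoX m hc0 hc2.le ht
  have hmass := hw.le_integral_crossings (continuousOn_peanoX_Icc_zero ht.2) hc0
  have hmass' : peanoC c * t - 1 / 9 ^ m - (9 ^ m + 2) * c ^ 2 ≤
      c * ∫ z, (crossings peanoX z c 0 t : ℝ) := hwle.trans (by gcongr)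
  have hmassB := mul_le_mul_of_nonneg_left hmass' hB0
  have hi := integrable_crossings_mul (continuousOn_peanoX_Icc_zero ht.2) ht.1 hc0 hg
  have hiB := integrable_crossings_mul (continuousOn_peanoX_Icc_zero ht.2) ht.1 hc0
    (continuous_const (y := B))
  have hII : IntervalIntegrable (fun s => g (peanoX s)) volume 0 t :=
    ((hg.comp_continuousOn continuousOn_peanoX).mono
      (uIcc_subset_Icc (by simp) ht)).intervalIntegrable
  simp only [mul_add, mul_sub] at hplus hminus
  rw [integral_add hiB hi, integral_mul_const,
    intervalIntegral.integral_add intervalIntegrable_const hII,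
    intervalIntegral.integral_const, smul_eq_mul, sub_zero] at hplus
  rw [integral_sub hiB hi, integral_mul_const,
    intervalIntegral.integral_sub intervalIntegrable_const hII,
    intervalIntegral.integral_const, smul_eq_mul, sub_zero] at hminus
  have h9 : (1 / 9 : ℝ) ^ m = 1 / 9 ^ m := by rw [one_div, inv_pow, one_div]
  rw [h9] at hm2
  have e1 : 2 * B / 9 ^ m = 2 * (B * (1 / 9 ^ m)) := by ring
  rw [abs_lt]
  constructor <;> linarith

/-! ### The occupation measure -/

theorem integral_zero_one_eq_sum {F : ℝ → ℝ} (hF : ContinuousOn F (Icc 0 1)) {N : ℕ} (hN : 0 < N) :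
    ∫ s in (0 : ℝ)..1, F s =
      (1 / N) * ∑ k ∈ Finset.range N, ∫ s in (0 : ℝ)..1, F ((k + s) / N) := by
  have hN' : (0 : ℝ) < N := by exact_mod_cast hN
  have h := intervalIntegral.sum_integral_adjacent_intervals (μ := volume)
    (f := F) (a := fun i : ℕ => (i : ℝ) / N) (n := N) fun k hk => by
      have hk1 : ((k + 1 : ℕ) : ℝ) ≤ N := by exact_mod_cast hk
      refine (hF.mono (uIcc_subset_Icc ⟨by positivity, ?_⟩ ⟨by positivity, ?_⟩)).intervalIntegrable
      · rw [div_le_one hN']; push_cast at hk1; linarith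
      · rwa [div_le_one hN']
  rw [Nat.cast_zero, zero_div, div_self hN'.ne'] at h
  rw [← h, Finset.mul_sum]
  refine Finset.sum_congr rfl fun k _ => ?_
  have := intervalIntegral.integral_comp_div_add (a := 0) (b := 1) F hN'.ne' ((k : ℝ) / N)
  rw [show (fun s : ℝ => F ((k + s) / N)) = fun s => F (s / N + k / N) by
    funext s; congr 1; ring, this, smul_eq_mul, ← mul_assoc, one_div_mul_cancel hN'.ne', one_mul,
    zero_div, zero_add]
  congr 1
  push_cast
  ring

/-- Substituting y ↦ (a + y)/3 into g coarsens the oscillation scale by a factor of 3, which drives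
the induction; the three cells of column a each reproduce the integral of g over that third. -/
theorem abs_integral_comp_peanoX_sub_le (m : ℕ) {g : ℝ → ℝ} (hg : Continuous g) {ε : ℝ}
    (hω : ∀ y ∈ Icc (0 : ℝ) 1, ∀ z ∈ Icc (0 : ℝ) 1, |y - z| ≤ (1 / 3) ^ m → |g y - g z| ≤ ε) :
    |(∫ s in (0 : ℝ)..1, g (peanoX s)) - ∫ s in (0 : ℝ)..1, g s| ≤ ε := by
  have hII : ∀ {g : ℝ → ℝ}, Continuous g →
      IntervalIntegrable (fun s => g (peanoX s)) volume 0 1 := fun hg =>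
    ((hg.comp_continuousOn continuousOn_peanoX).mono (by simp)).intervalIntegrable
  induction m generalizing g with
  | zero =>
    rw [← intervalIntegral.integral_sub (hII hg) (hg.intervalIntegrable _ _)]
    have := intervalIntegral.norm_integral_le_of_norm_le_const (a := 0) (b := 1) (C := ε)
      (f := fun s => g (peanoX s) - g s) fun s hs => by
        rw [uIoc_of_le zero_le_one] at hs
        have hs' : s ∈ Icc (0 : ℝ) 1 := ⟨hs.1.le, hs.2⟩
        have hx := peanoX_mem_Icc s
        refine hω _ hx _ hs' ?_
        -- At scale 1 the oscillation bound covers every pair in [0,1], in particular x(s) and s.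
        rw [pow_zero, abs_le]
        constructor <;> linarith [hx.1, hx.2, hs'.1, hs'.2]
    simpa using this
  | succ m ih =>
    have key : ∀ a b : ℕ, a < 3 → b < 3 →
        |(∫ s in (0 : ℝ)..1, g (peanoX ((3 * a + b + s) / 9))) -
          ∫ s in (0 : ℝ)..1, g ((a + s) / 3)| ≤ ε := by
      intro a b ha hb
      have ha' : (a : ℝ) ≤ 2 := by exact_mod_cast Nat.le_of_lt_succ ha
      have ha0 : (0 : ℝ) ≤ a := a.cast_nonneg
      have hmem : ∀ y ∈ Icc (0 : ℝ) 1, (a + y) / 3 ∈ Icc (0 : ℝ) 1 := fun y hy =>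
        ⟨by linarith [hy.1], by linarith [hy.2]⟩
      have h1 : ∀ y ∈ Icc (0 : ℝ) 1, ∀ z ∈ Icc (0 : ℝ) 1, |y - z| ≤ (1 / 3) ^ m →
          |g ((a + y) / 3) - g ((a + z) / 3)| ≤ ε := fun y hy z hz hyz => by
        refine hω _ (hmem y hy) _ (hmem z hz) ?_
        rw [show (a + y) / 3 - (a + z) / 3 = (y - z) * (1 / 3) by ring, abs_mul, pow_succ,
          abs_of_pos (by norm_num : (0 : ℝ) < 1 / 3)]
        gcongr
      have hcongr : ∫ s in (0 : ℝ)..1, g (peanoX ((3 * a + b + s) / 9)) =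
          ∫ s in (0 : ℝ)..1, g ((a + if b = 1 then 1 - peanoX s else peanoX s) / 3) := by
        refine intervalIntegral.integral_congr fun s hs => ?_
        rw [uIcc_of_le zero_le_one] at hs
        simp only [peanoX_subcell ha hb hs]
      rw [hcongr]
      by_cases hb1 : b = 1
      · simp only [if_pos hb1]
        have := ih (g := fun y => g ((a + (1 - y)) / 3)) (by fun_prop) fun y hy z hz hyz =>
          h1 _ ⟨by linarith [hy.2], by linarith [hy.1]⟩ _ ⟨by linarith [hz.2], by linarith [hz.1]⟩
            (by rwa [sub_sub_sub_cancel_left, abs_sub_comm])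
        -- The reversed middle cell is harmless because Lebesgue measure on [0,1] is invariant under
        -- reflection.
        have hsymm := intervalIntegral.integral_comp_sub_left (a := 0) (b := 1)
          (fun y => g ((a + y) / 3)) 1
        rw [hsymm, sub_self, sub_zero] at this
        exact this
      · simp only [if_neg hb1]
        exact ih (g := fun y => g ((a + y) / 3)) (by fun_prop) h1
    have e1 := integral_zero_one_eq_sum (hg.comp_continuousOn continuousOn_peanoX)
      (N := 9) (by norm_num)
    have e2 := integral_zero_one_eq_sum hg.continuousOn (N := 3) (by norm_num)
    simp only [Finset.sum_range_succ, Finset.sum_range_zero, Function.comp_apply] at e1 e2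
    have k00 := abs_le.1 (key 0 0 (by norm_num) (by norm_num))
    have k01 := abs_le.1 (key 0 1 (by norm_num) (by norm_num))
    have k02 := abs_le.1 (key 0 2 (by norm_num) (by norm_num))
    have k10 := abs_le.1 (key 1 0 (by norm_num) (by norm_num))
    have k11 := abs_le.1 (key 1 1 (by norm_num) (by norm_num))
    have k12 := abs_le.1 (key 1 2 (by norm_num) (by norm_num))
    have k20 := abs_le.1 (key 2 0 (by norm_num) (by norm_num))
    have k21 := abs_le.1 (key 2 1 (by norm_num) (by norm_num))
    have k22 := abs_le.1 (key 2 2 (by norm_num) (by norm_num))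
    norm_num at e1 e2 k00 k01 k02 k10 k11 k12 k20 k21 k22
    rw [abs_le]
    constructor <;> linarith [k00.1, k00.2, k01.1, k01.2, k02.1, k02.2, k10.1, k10.2, k11.1, k11.2,
      k12.1, k12.2, k20.1, k20.2, k21.1, k21.2, k22.1, k22.2]

theorem integral_comp_peanoX {g : ℝ → ℝ} (hg : Continuous g) :
    ∫ s in (0 : ℝ)..1, g (peanoX s) = ∫ s in (0 : ℝ)..1, g s := by
  rw [← sub_eq_zero, ← abs_nonpos_iff]
  refine le_of_forall_pos_le_add fun ε hε => ?_
  obtain ⟨δ, hδ, hu⟩ := Metric.uniformContinuousOn_iff.1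
    (isCompact_Icc.uniformContinuousOn_of_continuous (s := Icc (0 : ℝ) 1) hg.continuousOn) ε hε
  obtain ⟨m, hm⟩ := exists_pow_lt_of_lt_one hδ (show (1 / 3 : ℝ) < 1 by norm_num)
  rw [zero_add]
  exact abs_integral_comp_peanoX_sub_le m hg fun y hy z hz h => (hu y hy z hz (h.trans_lt hm)).le

theorem aemeasurable_peanoX {t : ℝ} (ht : t ≤ 1) :
    AEMeasurable peanoX (volume.restrict (Ioc 0 t)) :=
  (continuousOn_peanoX.mono fun _ hs => ⟨hs.1.le, hs.2.trans ht⟩).aemeasurable measurableSet_Ioc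

theorem map_peanoX : (volume.restrict (Ioc (0 : ℝ) 1)).map peanoX = volume.restrict (Ioc 0 1) := by
  refine ext_of_forall_integral_eq_of_IsFiniteMeasure fun g => ?_
  rw [integral_map (aemeasurable_peanoX le_rfl) g.continuous.aestronglyMeasurable,
    ← intervalIntegral.integral_of_le zero_le_one, ← intervalIntegral.integral_of_le zero_le_one]
  exact integral_comp_peanoX g.continuous

/-- The occupation measure up to t is dominated by the one up to time 1, which is Lebesgue measure
on the unit interval. -/
theorem map_peanoX_absolutelyContinuous {t : ℝ} (ht : t ≤ 1) :
    (volume.restrict (Ioc (0 : ℝ) t)).map peanoX ≪ volume := by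
  refine Measure.AbsolutelyContinuous.trans ?_ (Measure.absolutelyContinuous_of_le
    (Measure.restrict_le_self (s := Ioc (0 : ℝ) 1)))
  rw [← map_peanoX]
  refine Measure.AbsolutelyContinuous.mk fun s hs h0 => ?_
  rw [Measure.map_apply_of_aemeasurable (aemeasurable_peanoX le_rfl) hs] at h0
  rw [Measure.map_apply_of_aemeasurable (aemeasurable_peanoX ht) hs]
  exact Measure.absolutelyContinuous_of_le
    (Measure.restrict_mono (Ioc_subset_Ioc_right ht) le_rfl) h0

/-! ### Local times and continuous test functions. -/

theorem exists_isLocalTime_peanoX : ∃ L, IsLocalTime peanoX L := by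
  refine ⟨fun t z => (((volume.restrict (Ioc (0 : ℝ) t)).map peanoX).rnDeriv volume z).toReal,
    fun t _ z => ENNReal.toReal_nonneg, fun t _ => (Measure.measurable_rnDeriv _ _).ennreal_toReal,
    fun t _ => Measure.integrable_toReal_rnDeriv, fun t ht g hg hB => ?_⟩
  rw [intervalIntegral.integral_of_le ht.1,
    ← integral_map (aemeasurable_peanoX ht.2) hg.aestronglyMeasurable,
    ← integral_rnDeriv_smul (map_peanoX_absolutelyContinuous ht.2)]
  simp only [smul_eq_mul, mul_comm]

theorem IsLocalTime.ae_eq_zero {L : ℝ → ℝ → ℝ} (hL : IsLocalTime peanoX L) {t : ℝ}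
    (ht : t ∈ Icc (0 : ℝ) 1) : ∀ᵐ z, z ∉ Icc (0 : ℝ) 1 → L t z = 0 := by
  have hS : MeasurableSet (Icc (0 : ℝ) 1)ᶜ := measurableSet_Icc.compl
  have h := hL.occupation t ht ((Icc (0 : ℝ) 1)ᶜ.indicator fun _ => (1 : ℝ))
    (measurable_const.indicator hS) ⟨1, fun z => by
      by_cases hz : z ∈ (Icc (0 : ℝ) 1)ᶜ <;> simp [indicator, hz]⟩
  have hl : ∀ s, (Icc (0 : ℝ) 1)ᶜ.indicator (fun _ => (1 : ℝ)) (peanoX s) = 0 := fun s =>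
    indicator_of_notMem (notMem_compl_iff.2 (peanoX_mem_Icc s)) _
  have hr : ∀ z, (Icc (0 : ℝ) 1)ᶜ.indicator (fun _ => (1 : ℝ)) z * L t z =
      (Icc (0 : ℝ) 1)ᶜ.indicator (L t) z := fun z => by
    by_cases hz : z ∈ (Icc (0 : ℝ) 1)ᶜ <;> simp [indicator, hz]
  simp only [hl, hr, intervalIntegral.integral_zero] at h
  have h0 := (integral_eq_zero_iff_of_nonneg
    (fun z => indicator_nonneg (fun z _ => hL.nonneg t ht z) z)
    ((hL.integrable t ht).indicator hS)).1 h.symm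
  filter_upwards [h0] with z hz hz'
  rwa [indicator_of_mem (show z ∈ (Icc (0 : ℝ) 1)ᶜ from hz')] at hz

theorem IsLocalTime.integrable_mul {L : ℝ → ℝ → ℝ} (hL : IsLocalTime peanoX L) {t : ℝ}
    (ht : t ∈ Icc (0 : ℝ) 1) {g : ℝ → ℝ} (hg : Continuous g) :
    Integrable (fun z => L t z * g z) volume ∧
      ∫ z, L t z * g z = ∫ s in (0 : ℝ)..t, g (peanoX s) := by
  -- The occupation formula admits only bounded g; clamping the argument to [0,1] changes nothing
  -- where the local time is nonzero, up to a null set.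
  set G : ℝ → ℝ := fun z => g (projIcc 0 1 zero_le_one z)
  have hGc : Continuous G := hg.comp (continuous_subtype_val.comp continuous_projIcc)
  obtain ⟨B, hB⟩ := isCompact_Icc.exists_bound_of_continuousOn (s := Icc (0 : ℝ) 1)
    hg.continuousOn
  have hGB : ∀ z, |G z| ≤ B := fun z => hB _ (projIcc 0 1 zero_le_one z).2
  have hGg : ∀ z ∈ Icc (0 : ℝ) 1, G z = g z := fun z hz => by
    simp only [G, projIcc_of_mem zero_le_one hz]
  have hae : (fun z => G z * L t z) =ᵐ[volume] fun z => L t z * g z := by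
    filter_upwards [hL.ae_eq_zero ht] with z hz
    by_cases h : z ∈ Icc (0 : ℝ) 1
    · rw [hGg z h, mul_comm]
    · rw [hz h, mul_zero, zero_mul]
  refine ⟨((hL.integrable t ht).bdd_mul (c := B) hGc.aestronglyMeasurable
    (ae_of_all _ hGB)).congr hae, ?_⟩
  rw [← integral_congr_ae hae, ← hL.occupation t ht G hGc.measurable ⟨B, hGB⟩]
  simp only [hGg _ (peanoX_mem_Icc _)]

/-! ### The normalization -/

theorem peanoPhi_eq {c : ℝ} (hc : 0 < c) :
    peanoPhi c = 1 / (peanoScale c * (1 - 3 / 4 * (peanoScale c * c))) := by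
  rw [peanoPhi, peanoC, show peanoScale c * c * (1 - 3 / 4 * (peanoScale c * c)) =
    c * (peanoScale c * (1 - 3 / 4 * (peanoScale c * c))) by ring, div_mul_eq_div_div,
    div_self hc.ne']

theorem peanoPhi_nonneg {c : ℝ} (hc : 0 < c) : 0 ≤ peanoPhi c :=
  div_nonneg hc.le (by linarith [(peanoC_mem hc).1])

theorem tendsto_peanoPhi : Tendsto peanoPhi (𝓝[>] 0) (𝓝 0) := by
  have h4 : Tendsto (fun c : ℝ => 4 * c) (𝓝[>] 0) (𝓝 0) :=
    (Continuous.tendsto' (by fun_prop) 0 0 (by simp)).mono_left nhdsWithin_le_nhds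
  refine squeeze_zero' ?_ ?_ h4
  · filter_upwards [self_mem_nhdsWithin] with c hc using peanoPhi_nonneg hc
  · filter_upwards [self_mem_nhdsWithin] with c hc
    replace hc : 0 < c := hc
    have := (peanoC_mem hc).1
    rw [peanoPhi, div_le_iff₀ (by linarith)]
    nlinarith

theorem inv_peanoPhi {p : ℝ} {n : ℤ} (hl : (3 : ℝ) ^ (-(n + 1)) < p) (hr : p ≤ (3 : ℝ) ^ (-n)) :
    (peanoPhi p)⁻¹ = (3 : ℝ) ^ n * (1 - 3 / 4 * ((3 : ℝ) ^ n * p)) := by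
  rw [peanoPhi_eq (lt_trans (by positivity) hl), peanoScale_eq_zpow hl hr, one_div, inv_inv]

/-- On either side 1/φ is affine, k(1 - 3kp/4), with k = 3^n to the left and k = 3^{n-1} to the
right. The values agree at 3^{-n}, but the slopes -3k²/4 do not. -/
theorem not_differentiableAt_peanoPhi (n : ℤ) :
    ¬ DifferentiableAt ℝ peanoPhi ((3 : ℝ) ^ (-n)) := by
  intro h
  set a : ℝ := (3 : ℝ) ^ (-n) with ha
  have ha0 : 0 < a := by positivity
  have hna : (3 : ℝ) ^ n * a = 1 := by rw [ha, ← zpow_add₀ (by norm_num)]; simp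
  have hna' : (3 : ℝ) ^ (n - 1) = (3 : ℝ) ^ n / 3 := by rw [zpow_sub_one₀ (by norm_num)]; rfl
  have hne : peanoPhi a ≠ 0 :=
    (div_pos ha0 (by linarith [(peanoC_mem ha0).1])).ne'
  have hd := (h.inv hne).hasDerivAt
  have hlin : ∀ k : ℝ, HasDerivAt (fun p : ℝ => k * (1 - 3 / 4 * (k * p)))
      (-(3 / 4) * k ^ 2) a := by
    intro k
    have := (((((hasDerivAt_id a).const_mul k).const_mul (3 / 4)).const_sub 1).const_mul k)
    convert! this using 1
    ring
  have h3 : a / 3 < a := by linarith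
  have hl : (peanoPhi⁻¹) =ᶠ[𝓝[Iic a] a] fun p => (3 : ℝ) ^ n * (1 - 3 / 4 * ((3 : ℝ) ^ n * p)) := by
    filter_upwards [self_mem_nhdsWithin, nhdsWithin_le_nhds (Ioi_mem_nhds h3)] with p hp hp'
    refine inv_peanoPhi ?_ hp
    rw [neg_add, ← sub_eq_add_neg, zpow_sub_one₀ (by norm_num), ← div_eq_mul_inv]
    exact hp'
  have hr : (peanoPhi⁻¹) =ᶠ[𝓝[Ici a] a]
      fun p => (3 : ℝ) ^ (n - 1) * (1 - 3 / 4 * ((3 : ℝ) ^ (n - 1) * p)) := by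
    filter_upwards [self_mem_nhdsWithin,
      nhdsWithin_le_nhds (Iio_mem_nhds (show a < 3 * a by linarith))] with p hp hp'
    rcases (show a ≤ p from hp).eq_or_lt with rfl | hlt
    · have := inv_peanoPhi (p := a) (n := n) (by
        rw [neg_add, ← sub_eq_add_neg, zpow_sub_one₀ (by norm_num), ← div_eq_mul_inv]
        exact h3) le_rfl
      rw [Pi.inv_apply, this, hna', hna, show (3 : ℝ) ^ n / 3 * a = ((3 : ℝ) ^ n * a) / 3 by ring,
        hna]
      ring
    · refine inv_peanoPhi (by rw [sub_add_cancel]; exact hlt) ?_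
      rw [neg_sub, sub_eq_add_neg, zpow_add₀ (by norm_num), zpow_one]
      exact (show p < 3 * a from hp').le
  have dl := (uniqueDiffWithinAt_Iic a).eq_deriv _ hd.hasDerivWithinAt
    ((hlin _).hasDerivWithinAt.congr_of_eventuallyEq hl (hl.self_of_nhdsWithin self_mem_Iic))
  have dr := (uniqueDiffWithinAt_Ici a).eq_deriv _ hd.hasDerivWithinAt
    ((hlin _).hasDerivWithinAt.congr_of_eventuallyEq hr (hr.self_of_nhdsWithin self_mem_Ici))
  rw [dl, hna'] at dr
  have : (0 : ℝ) < ((3 : ℝ) ^ n) ^ 2 := by positivity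
  nlinarith

/-! ### Limits -/

theorem tendsto_three_zpow_neg_mul {p : ℝ} (hp : 0 < p) :
    Tendsto (fun n : ℕ => (3 : ℝ) ^ (-(n : ℤ)) * p) atTop (𝓝[>] 0) := by
  refine tendsto_nhdsWithin_iff.2 ⟨?_, Eventually.of_forall fun n => ?_⟩
  · have : Tendsto (fun n : ℕ => (1 / 3 : ℝ) ^ n * p) atTop (𝓝 (0 * p)) :=
      (tendsto_pow_atTop_nhds_zero_of_lt_one (by norm_num) (by norm_num)).mul_const p
    rw [zero_mul] at this
    refine this.congr fun n => ?_
    rw [zpow_neg, zpow_natCast, one_div, inv_pow]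
  · have : (0 : ℝ) < (3 : ℝ) ^ (-(n : ℤ)) * p := by positivity
    exact this

theorem eventually_truncatedVariation_mem {ε : ℝ} (hε : 0 < ε) :
    ∀ᶠ c : ℝ in 𝓝[>] 0, ∀ t ∈ Icc (0 : ℝ) 1,
      ENNReal.ofReal c * truncatedVariation peanoX 0 t c ∈
        Icc (ENNReal.ofReal (peanoC c * t - ε)) (ENNReal.ofReal (peanoC c * t + ε)) := by
  obtain ⟨m, hm⟩ := exists_pow_lt_of_lt_one (half_pos hε) (show (1 / 9 : ℝ) < 1 by norm_num)
  rw [one_div, inv_pow, ← one_div] at hm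
  have hlim : ∀ᶠ c : ℝ in 𝓝[>] 0, ((9 : ℝ) ^ m + 2) * c ^ 2 < ε / 2 := by
    refine nhdsWithin_le_nhds (ContinuousAt.eventually_lt (by fun_prop) continuousAt_const ?_)
    simp; linarith
  have hlim' : ∀ᶠ c : ℝ in 𝓝[>] 0, 3 ^ m * c < 1 :=
    nhdsWithin_le_nhds (ContinuousAt.eventually_lt (by fun_prop) continuousAt_const (by simp))
  filter_upwards [hlim, hlim', self_mem_nhdsWithin,
    eventually_abs_crossings_sub_lt (continuous_const (y := (1 : ℝ))) hε] with c hc1 hc2 hc0 hc t ht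
  replace hc0 : 0 < c := hc0
  constructor
  · obtain ⟨w, hw, hwle⟩ := exists_partitionSum_peanoX m hc0 hc2.le ht
    calc ENNReal.ofReal (peanoC c * t - ε) ≤ ENNReal.ofReal (c * w) :=
          ENNReal.ofReal_le_ofReal (by linarith)
      _ = ENNReal.ofReal c * ENNReal.ofReal w := ENNReal.ofReal_mul hc0.le
      _ ≤ _ := by gcongr; exact hw.ofReal_le_truncatedVariation
  · have h1 := (abs_lt.1 (hc t ht)).2
    simp only [mul_one, intervalIntegral.integral_const, smul_eq_mul, sub_zero] at h1
    calc ENNReal.ofReal c * truncatedVariation peanoX 0 t c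
        ≤ ENNReal.ofReal c * ENNReal.ofReal (∫ z, (crossings peanoX z c 0 t : ℝ)) := by
          gcongr
          exact truncatedVariation_le_integral_crossings (continuousOn_peanoX_Icc_zero ht.2)
            ht.1 hc0
      _ = ENNReal.ofReal (c * ∫ z, (crossings peanoX z c 0 t : ℝ)) :=
          (ENNReal.ofReal_mul hc0.le).symm
      _ ≤ _ := ENNReal.ofReal_le_ofReal (by linarith)

theorem tendsto_truncatedVariation_peanoX {p t : ℝ} (hp : 0 < p) (ht : t ∈ Icc (0 : ℝ) 1) :
    Tendsto (fun n : ℕ => ENNReal.ofReal ((3 : ℝ) ^ (-(n : ℤ)) * p) *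
      truncatedVariation peanoX 0 t ((3 : ℝ) ^ (-(n : ℤ)) * p))
      atTop (𝓝 (ENNReal.ofReal (peanoC p * t))) := by
  set X : ℕ → ℝ≥0∞ := fun n => ENNReal.ofReal ((3 : ℝ) ^ (-(n : ℤ)) * p) *
      truncatedVariation peanoX 0 t ((3 : ℝ) ^ (-(n : ℤ)) * p)
  have hCt : 0 ≤ peanoC p * t := mul_nonneg (by linarith [(peanoC_mem hp).1]) ht.1
  have hX : ∀ ε > 0, ∀ᶠ n in atTop, X n ∈
      Icc (ENNReal.ofReal (peanoC p * t - ε)) (ENNReal.ofReal (peanoC p * t + ε)) := by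
    intro ε hε
    filter_upwards [(tendsto_three_zpow_neg_mul hp).eventually
      (eventually_truncatedVariation_mem hε)] with n hn
    have := hn t ht
    rwa [peanoC_zpow_mul hp] at this
  -- Eventual finiteness lets the convergence be checked in ℝ.
  have hfin : ∀ᶠ n in atTop, X n ≠ ∞ := by
    filter_upwards [hX 1 one_pos] with n hn
    exact ne_top_of_le_ne_top ENNReal.ofReal_ne_top hn.2
  have hreal : Tendsto (fun n => (X n).toReal) atTop (𝓝 (peanoC p * t)) := by
    rw [Metric.tendsto_nhds]
    intro ε hε
    filter_upwards [hX (ε / 2) (half_pos hε), hfin] with n hn hn'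
    have h1 := (ENNReal.ofReal_le_iff_le_toReal hn').1 hn.1
    have h2 := ENNReal.toReal_le_of_le_ofReal (by linarith) hn.2
    rw [Real.dist_eq, abs_lt]
    constructor <;> linarith
  refine (ENNReal.tendsto_ofReal hreal).congr' ?_
  filter_upwards [hfin] with n hn using ENNReal.ofReal_toReal hn

theorem tendstoUniformlyOn_crossings_peanoX {p : ℝ} (hp : 0 < p) {g : ℝ → ℝ} (hg : Continuous g) :
    TendstoUniformlyOn
      (fun (n : ℕ) (t : ℝ) => (3 : ℝ) ^ (-(n : ℤ)) * p *
        ∫ z, (crossings peanoX z ((3 : ℝ) ^ (-(n : ℤ)) * p) 0 t : ℝ) * g z)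
      (fun t => peanoC p * ∫ s in (0 : ℝ)..t, g (peanoX s)) atTop (Icc (0 : ℝ) 1) := by
  rw [Metric.tendstoUniformlyOn_iff]
  intro ε hε
  filter_upwards [(tendsto_three_zpow_neg_mul hp).eventually
    (eventually_abs_crossings_sub_lt hg hε)] with n hn t ht
  have := hn t ht
  rw [peanoC_zpow_mul hp] at this
  rwa [dist_comm, Real.dist_eq]

theorem tendsto_peanoPhi_mul_crossings {g : ℝ → ℝ} (hg : Continuous g) {t : ℝ}
    (ht : t ∈ Icc (0 : ℝ) 1) :
    Tendsto (fun c : ℝ => ∫ z, peanoPhi c * (crossings peanoX z c 0 t : ℝ) * g z)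
      (𝓝[>] 0) (𝓝 (∫ s in (0 : ℝ)..t, g (peanoX s))) := by
  rw [Metric.tendsto_nhds]
  intro ε hε
  filter_upwards [self_mem_nhdsWithin,
    -- The tolerance ε/4 compensates for division by C_c ≥ 1/4.
    eventually_abs_crossings_sub_lt hg (show 0 < ε / 4 by linarith)] with c hc0 hc
  have hC := (peanoC_mem hc0).1
  have hC0 : 0 < peanoC c := by linarith
  have h := hc t ht
  simp only [mul_assoc, integral_const_mul]
  rw [Real.dist_eq, peanoPhi]
  have e : c / peanoC c * (∫ z, (crossings peanoX z c 0 t : ℝ) * g z) -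
      ∫ s in (0 : ℝ)..t, g (peanoX s) = (c * (∫ z, (crossings peanoX z c 0 t : ℝ) * g z) -
        peanoC c * ∫ s in (0 : ℝ)..t, g (peanoX s)) / peanoC c := by
    field_simp
  rw [e, abs_div, abs_of_pos hC0, div_lt_iff₀ hC0]
  nlinarith

theorem mainTheorem3 :
    -- the normalization `φ` and the constants `C`
    (∀ c ∈ Ioo (0 : ℝ) 1,
      0 ≤ peanoPhi c ∧
      peanoPhi c = 1 / (peanoScale c * (1 - 3 / 4 * (peanoScale c * c)))) ∧
    Tendsto peanoPhi (𝓝[>] 0) (𝓝 0) ∧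
    (∀ p : ℝ, 0 < p → ∀ k : ℤ, peanoC ((3 : ℝ) ^ k * p) = peanoC p) ∧
    (∀ n : ℕ, 1 ≤ n → ¬ DifferentiableAt ℝ peanoPhi ((3 : ℝ) ^ (-(n : ℤ)))) ∧
    -- truncated variation
    (∀ p : ℝ, 0 < p → ∀ t ∈ Icc (0 : ℝ) 1,
      Tendsto (fun n : ℕ => ENNReal.ofReal ((3 : ℝ) ^ (-(n : ℤ)) * p) *
          truncatedVariation peanoX 0 t ((3 : ℝ) ^ (-(n : ℤ)) * p))
        atTop (𝓝 (ENNReal.ofReal (peanoC p * t)))) ∧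
    -- the integrals of the crossing numbers make sense
    (∀ g : ℝ → ℝ, Continuous g → ∀ t ∈ Icc (0 : ℝ) 1, ∀ c : ℝ, 0 < c →
      Integrable (fun z => (crossings peanoX z c 0 t : ℝ) * g z) volume) ∧
    -- crossing numbers along `3⁻ⁿ p`, uniformly in `t`
    (∀ p : ℝ, 0 < p → ∀ g : ℝ → ℝ, Continuous g →
      TendstoUniformlyOn
        (fun (n : ℕ) (t : ℝ) => (3 : ℝ) ^ (-(n : ℤ)) * p *
          ∫ z, (crossings peanoX z ((3 : ℝ) ^ (-(n : ℤ)) * p) 0 t : ℝ) * g z)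
        (fun t => peanoC p * ∫ s in (0 : ℝ)..t, g (peanoX s))
        atTop (Icc (0 : ℝ) 1)) ∧
    -- local time as the weak limit of normalized crossing numbers
    (∃ L, IsLocalTime peanoX L) ∧
    (∀ L, IsLocalTime peanoX L → ∀ g : ℝ → ℝ, Continuous g → ∀ t ∈ Icc (0 : ℝ) 1,
      Integrable (fun z => L t z * g z) volume ∧
      Tendsto (fun c : ℝ => ∫ z, peanoPhi c * (crossings peanoX z c 0 t : ℝ) * g z)
        (𝓝[>] 0) (𝓝 (∫ z, L t z * g z))) := by
  refine ⟨fun c hc => ⟨peanoPhi_nonneg hc.1, peanoPhi_eq hc.1⟩, tendsto_peanoPhi,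
    fun p hp k => peanoC_zpow_mul hp k, fun n _ => not_differentiableAt_peanoPhi n,
    fun p hp t ht => tendsto_truncatedVariation_peanoX hp ht,
    fun g hg t ht c hc => integrable_crossings_mul (continuousOn_peanoX_Icc_zero ht.2) ht.1 hc hg,
    fun p hp g hg => tendstoUniformlyOn_crossings_peanoX hp hg, exists_isLocalTime_peanoX,
    fun L hL g hg t ht => ?_⟩
  obtain ⟨h1, h2⟩ := hL.integrable_mul ht hg
  exact ⟨h1, h2 ▸ tendsto_peanoPhi_mul_crossings hg ht⟩
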